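/- **Conventions.** Write $\mathbb T=\mathbb R/\mathbb Z$, let $[x]$ be the integer part (floor) of $x$, and let $f\prec g$ mean $f(t)/g(t)\to 0$ as $t\to+\infty$. A *Hardy field* is a subfield of the ring of germs at $+\infty$ of real-valued functions which is closed under differentiation and under the translations $f(t)\mapsto f(t+h)$, $h\in\mathbb R$; a *Hardy field function* is a function whose germ belongs to some Hardy field. A real function $\phi$ on $\mathbb T$ is *Riemann-integrable* if it is Borel measurable and for every $\varepsilon>0$ there are continuous $\phi^-\le\phi\le\phi^+$ with $\int_{\mathbb T}(\phi^+-\phi^-)\,dm_{\mathbb T}\le\varepsilon$; a complex function is Riemann-integrable if its real and imaginary parts are. Let $Y$ be a compact metric space and $T$ the shift $(Tx)(n)=x(n+1)$ on $Y^{\mathbb Z}$. A sequence $b\colon\mathbb N\to Y$, where $\mathbb N=\{1,2,\dots\}$, *has a unique Furstenberg system* if the weak-star limit $\mu=\lim_{M\to\infty}\frac1M\sum_{m=1}^M\delta_{T^m b}$ exists on $Y^{\mathbb Z}$, where $b$ is extended to $\mathbb Z$ in an arbitrary way (the limit does not depend on the extension); the unique Furstenberg system is then $(Y^{\mathbb Z},\mu,T)$.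 The joint Furstenberg system of two sequences is that of the sequence of pairs. A system $(X,\mu,T)$ (an invertible bimeasurable transformation preserving a probability measure) is a *factor* of $(X',\mu',T')$ if there is a measurable $\pi\colon X'\to X$ with $\pi_*\mu'=\mu$ and $\pi\circ T'=T\circ\pi$ $\mu'$-a.e.; the two systems are *isomorphic* if there are factor maps in both directions that are inverse to each other almost everywhere. For $d\ge 0$ let $S_d\colon\mathbb T^{d+1}\to\mathbb T^{d+1}$ be $$S_d(y_0,\dots,y_d)=(y_0,\,y_1+y_0,\,\dots,\,y_d+y_{d-1}),$$ and let $m_{\mathbb T^{2(d+1)}}$ be the Haar probability measure on $\mathbb T^{2(d+1)}=\mathbb T^{d+1}\times\mathbb T^{d+1}$. **Theorem.** Let $d\ge0$ be an integer, let $a\colon\mathbb R_+\to\mathbb R$ be a Hardy field function with $t^d\log t\prec a(t)\prec t^{d+1}$, and let $\alpha\in\mathbb R\setminus\mathbb Q$. 1. Let $\phi\colon\mathbb T\to\mathbb C$ be Riemann-integrable and $b(n):=\phi([a(n)]\alpha)$, $n\in\mathbb N$. Then $\phi$ is bounded, and $b$, regarded as a sequence in any compact set $K\subset\mathbb C$ that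 contains all its values, has a unique Furstenberg system, which is a factor of the system $(\mathbb T^{2(d+1)},m_{\mathbb T^{2(d+1)}},S_d\times S_d)$. 2. The pair of sequences $(a(n))_{n\in\mathbb N}$, $(\alpha a(n))_{n\in\mathbb N}$, taken mod $1$, has a unique joint Furstenberg system, and it is isomorphic to $(\mathbb T^{2(d+1)},m_{\mathbb T^{2(d+1)}},S_d\times S_d)$. -/

import Mathlib

open Filter Topology MeasureTheory Asymptotics

/-! ### Hardy fields -/

/-- A Hardy field: a subfield of the ring of germs at `+∞` of real functions that is closed under
differentiation.  As a standing convention, Hardy fields are also required to be invariant under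
the translations `t ↦ t + h`.  Total functions `ℝ → ℝ` represent the same germs as functions
defined on some half line. -/
structure IsHardyField (H : Subring (Germ (atTop : Filter ℝ) ℝ)) : Prop where
  isField : IsField H
  /-- the representatives are eventually differentiable, and the derivative is again in `H` -/
  deriv_mem : ∀ f : ℝ → ℝ, (f : Germ (atTop : Filter ℝ) ℝ) ∈ H →
    (∀ᶠ t in atTop, DifferentiableAt ℝ f t) ∧ (deriv f : Germ (atTop : Filter ℝ) ℝ) ∈ H
  translate_mem : ∀ (f : ℝ → ℝ) (h : ℝ), (f : Germ (atTop : Filter ℝ) ℝ) ∈ H →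
    ((fun t => f (t + h) : ℝ → ℝ) : Germ (atTop : Filter ℝ) ℝ) ∈ H

/-- A function is a Hardy field function if its germ at `+∞` belongs to some Hardy field. -/
def IsHardyFieldFunction (a : ℝ → ℝ) : Prop :=
  ∃ H : Subring (Germ (atTop : Filter ℝ) ℝ),
    IsHardyField H ∧ (a : Germ (atTop : Filter ℝ) ℝ) ∈ H

/-! ### Riemann-integrability -/

/-- Riemann-integrability of a real function with respect to a Borel measure on a compact metric
space: Borel measurable and sandwiched, for every `ε > 0`, between two continuous functions whose
integrals differ by at most `ε`. -/
def RealRiemannIntegrable {Y : Type*} [MetricSpace Y] [CompactSpace Y] [MeasurableSpace Y]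
    [BorelSpace Y] (φ : Y → ℝ) (ν : Measure Y) : Prop :=
  Measurable φ ∧ ∀ ε : ℝ, 0 < ε → ∃ φl φu : C(Y, ℝ),
    (∀ y, φl y ≤ φ y ∧ φ y ≤ φu y) ∧ ∫ y, (φu y - φl y) ∂ν ≤ ε

/-- A complex function is Riemann-integrable if its real and imaginary parts are. -/
def RiemannIntegrable {Y : Type*} [MetricSpace Y] [CompactSpace Y] [MeasurableSpace Y]
    [BorelSpace Y] (φ : Y → ℂ) (ν : Measure Y) : Prop :=
  RealRiemannIntegrable (fun y => (φ y).re) ν ∧ RealRiemannIntegrable (fun y => (φ y).im) ν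

/-! ### Measure preserving systems, factors, isomorphisms -/

/-- `(X, μ, T)` is a measure preserving system: `μ` is a probability measure and `T` is an
invertible, bimeasurable, measure preserving transformation. -/
structure IsSystem {X : Type*} [MeasurableSpace X] (μ : Measure X) (T : X → X) : Prop where
  isProbabilityMeasure : IsProbabilityMeasure μ
  invertible : ∃ e : X ≃ᵐ X, ⇑e = T
  measurePreserving : MeasurePreserving T μ μ

/-- The system `(X, μ, T)` is a factor of the system `(Y, ν, S)`. -/
def IsFactorOf {X Y : Type*} [MeasurableSpace X] [MeasurableSpace Y]
    (μ : Measure X) (T : X → X) (ν : Measure Y) (S : Y → Y) : Prop :=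
  IsSystem μ T ∧ IsSystem ν S ∧
    ∃ π : Y → X, MeasurePreserving π ν μ ∧ ∀ᵐ y ∂ν, π (S y) = T (π y)

/-- The systems `(X, μ, T)` and `(Y, ν, S)` are isomorphic: there are factor maps in both
directions that are inverse to each other almost everywhere. -/
def IsIsomorphicTo {X Y : Type*} [MeasurableSpace X] [MeasurableSpace Y]
    (μ : Measure X) (T : X → X) (ν : Measure Y) (S : Y → Y) : Prop :=
  IsSystem μ T ∧ IsSystem ν S ∧
    ∃ (π : Y → X) (ρ : X → Y), MeasurePreserving π ν μ ∧ MeasurePreserving ρ μ ν ∧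
      (∀ᵐ y ∂ν, π (S y) = T (π y)) ∧ (∀ᵐ x ∂μ, ρ (T x) = S (ρ x)) ∧
      (∀ᵐ y ∂ν, ρ (π y) = y) ∧ (∀ᵐ x ∂μ, π (ρ x) = x)

/-! ### Furstenberg systems -/

/-- The shift `(T x)(n) = x (n + 1)` on `Z^ℤ`. -/
def shift (Z : Type*) : (ℤ → Z) → (ℤ → Z) := fun x n => x (n + 1)

/-- `μ` is the weak-star limit as `M → ∞` of the averages of the point masses at `T^m z`,
`1 ≤ m ≤ M`, on `Z^ℤ`. -/
def IsOrbitLimit {Z : Type*} [MetricSpace Z] [CompactSpace Z] [MeasurableSpace Z]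
    (z : ℤ → Z) (μ : Measure (ℤ → Z)) : Prop :=
  IsProbabilityMeasure μ ∧ ∀ f : C(ℤ → Z, ℂ),
    Tendsto (fun M : ℕ => (M : ℂ)⁻¹ * ∑ m ∈ Finset.Icc 1 M, f ((shift Z)^[m] z)) atTop
      (𝓝 (∫ x, f x ∂μ))

/-- The sequence `(b(n))`, `n = 1, 2, …`, with values in a compact metric space `Z` has a unique
Furstenberg system, namely `(Z^ℤ, μ, shift)`.  The sequence is extended to `ℤ` in an arbitrary way
(the value `b 0` plays no role).  The joint Furstenberg system of several sequences is that of the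
sequence of tuples. -/
def HasUniqueFurstenbergSystem {Z : Type*} [MetricSpace Z] [CompactSpace Z] [MeasurableSpace Z]
    (b : ℕ → Z) (μ : Measure (ℤ → Z)) : Prop :=
  ∀ z : ℤ → Z, (∀ n : ℕ, 1 ≤ n → z n = b n) → IsOrbitLimit z μ

/-! ### The unipotent homomorphism -/

/-- `S_d (y_0, …, y_d) = (y_0, y_1 + y_0, …, y_d + y_{d-1})` on the torus of dimension `d + 1`. -/
def unipotent (d : ℕ) (y : Fin (d + 1) → UnitAddCircle) : Fin (d + 1) → UnitAddCircle :=
  Fin.cons (y 0) (fun j : Fin d => y j.succ + y j.castSucc)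

/-! Differences replace derivatives. Sampled at the integers, a Hardy field gives a family of
sequences closed under the field operations and the shift, each eventually of one sign, so each is
also eventually monotone. Put u = Δ^(d+1) a. Discrete integration turns a ≺ t^(d+1) into u → 0, and
t^d log t ≺ a into u ≠ O(1/n); eventual monotonicity of n u(n) then gives n|u(n)| → ∞ and Δu = o(u)
(`slow_iterate_fwdDiff`).

Let w(m) consist of Δ^d a(m), …, Δa(m), a(m) and of their multiples by α, mod 1. Since Δ^j a(m+1) =
Δ^j a(m) + Δ^(j+1) a(m), the points w(m+1) and (S_d × S_d) w(m) differ only in the two coordinates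
of index 0, by u(m) and α u(m), so w is asymptotically an orbit. By Weyl's criterion w is
equidistributed for Haar measure as soon as exponential sums along ∑ (k_i + α l_i) Δ^(d-i) a are
small; irrationality keeps some coefficient nonzero, and van der Corput's inequality reduces these
sums to Fejér's theorem (`tendsto_cesaroMean_unitExp_differences`).

The shifts of the sequence (a, αa) are therefore asymptotic to itineraries of equidistributed
points, seen through the pair of last coordinates, and the Furstenberg system is the image of Haar
measure under the itinerary map (`hasUniqueFurstenbergSystem_of_pseudoOrbit`). That map is injective
because earlier coordinates are differences of later ones along the orbit, whence the isomorphism.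

For b, use [a]α = αa - {a}α: this is a function of (a, αa) mod 1 that is continuous almost
everywhere and sends Haar measure to Haar measure. Its composition with φ is again continuous almost
everywhere, and such maps preserve weak convergence (`exists_hasUniqueFurstenbergSystem_comp`). -/

open scoped Uniformity ENNReal

/-! ### Sequences of eventually constant sign -/

/-- A real sequence is eventually positive, eventually zero or eventually negative. -/
def HasEventualSign (s : ℕ → ℝ) : Prop :=
  (∀ᶠ n in atTop, 0 < s n) ∨ (∀ᶠ n in atTop, s n = 0) ∨ (∀ᶠ n in atTop, s n < 0)

theorem fwdDiff_one_apply (s : ℕ → ℝ) (n : ℕ) : fwdDiff 1 s n = s (n + 1) - s n := rfl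

theorem exists_monotone_add {s : ℕ → ℝ} (h : ∀ᶠ n in atTop, s n ≤ s (n + 1)) :
    ∃ N, Monotone fun n => s (n + N) := by
  obtain ⟨N, hN⟩ := eventually_atTop.1 h
  refine ⟨N, monotone_nat_of_le_succ fun n => ?_⟩
  have := hN (n + N) (by omega)
  rwa [show n + 1 + N = n + N + 1 by omega]

theorem eventually_ge_of_eventually_le_succ {s : ℕ → ℝ} (h : ∀ᶠ n in atTop, s n ≤ s (n + 1)) :
    ∃ B, ∀ᶠ n in atTop, B ≤ s n := by
  obtain ⟨N, hN⟩ := exists_monotone_add h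
  refine ⟨s N, eventually_atTop.2 ⟨N, fun n hn => ?_⟩⟩
  have := hN (Nat.zero_le (n - N))
  simpa [Nat.sub_add_cancel hn] using this

namespace HasEventualSign

theorem congr {s t : ℕ → ℝ} (hs : HasEventualSign s) (h : s =ᶠ[atTop] t) :
    HasEventualSign t := by
  rcases hs with h1 | h1 | h1
  · exact Or.inl (by filter_upwards [h1, h] with n a b; rwa [← b])
  · exact Or.inr (Or.inl (by filter_upwards [h1, h] with n a b; rwa [← b]))
  · exact Or.inr (Or.inr (by filter_upwards [h1, h] with n a b; rwa [← b]))

theorem neg {s : ℕ → ℝ} (hs : HasEventualSign s) : HasEventualSign (-s) := by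
  rcases hs with h1 | h1 | h1
  · exact Or.inr (Or.inr (by filter_upwards [h1] with n a; simpa using a))
  · exact Or.inr (Or.inl (by filter_upwards [h1] with n a; simpa using a))
  · exact Or.inl (by filter_upwards [h1] with n a; simpa using a)

theorem mul {s t : ℕ → ℝ} (hs : HasEventualSign s) (ht : HasEventualSign t) :
    HasEventualSign (s * t) := by
  rcases hs with h1 | h1 | h1
  · rcases ht with h2 | h2 | h2
    · exact Or.inl (by filter_upwards [h1, h2] with n a b using mul_pos a b)
    · exact Or.inr (Or.inl (by filter_upwards [h2] with n b; simp [b]))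
    · exact Or.inr (Or.inr (by filter_upwards [h1, h2] with n a b using mul_neg_of_pos_of_neg a b))
  · exact Or.inr (Or.inl (by filter_upwards [h1] with n b; simp [b]))
  · rcases ht with h2 | h2 | h2
    · exact Or.inr (Or.inr (by filter_upwards [h1, h2] with n a b using mul_neg_of_neg_of_pos a b))
    · exact Or.inr (Or.inl (by filter_upwards [h2] with n b; simp [b]))
    · exact Or.inl (by filter_upwards [h1, h2] with n a b using mul_pos_of_neg_of_neg a b)

theorem of_eventually_lt_succ {s : ℕ → ℝ} (h : ∀ᶠ n in atTop, s n < s (n + 1)) :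
    HasEventualSign s := by
  obtain ⟨N, hN⟩ := eventually_atTop.1 h
  by_cases hex : ∃ m ≥ N, 0 ≤ s m
  · obtain ⟨m, hm, h0⟩ := hex
    refine Or.inl (eventually_atTop.2 ⟨m + 1, fun n hn => ?_⟩)
    induction n, hn using Nat.le_induction with
    | base => linarith [hN m hm]
    | succ k hk ih => linarith [hN k (by omega)]
  · push Not at hex
    exact Or.inr (Or.inr (eventually_atTop.2 ⟨N, hex⟩))

/-- A sequence whose differences are eventually of constant sign is eventually of constant sign. -/
theorem of_fwdDiff {s : ℕ → ℝ} (h : HasEventualSign (fwdDiff 1 s)) : HasEventualSign s := by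
  rcases h with h | h | h
  · exact of_eventually_lt_succ (by filter_upwards [h] with n hn; linarith [fwdDiff_one_apply s n])
  · obtain ⟨N, hN⟩ := eventually_atTop.1 h
    have hc : ∀ n ≥ N, s n = s N := by
      intro n hn
      induction n, hn using Nat.le_induction with
      | base => rfl
      | succ k hk ih => linarith [hN k hk, fwdDiff_one_apply s k]
    rcases lt_trichotomy (s N) 0 with h0 | h0 | h0
    · exact Or.inr (Or.inr (eventually_atTop.2 ⟨N, fun n hn => by rwa [hc n hn]⟩))
    · exact Or.inr (Or.inl (eventually_atTop.2 ⟨N, fun n hn => by rwa [hc n hn]⟩))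
    · exact Or.inl (eventually_atTop.2 ⟨N, fun n hn => by rwa [hc n hn]⟩)
  · rw [← neg_neg s]
    refine neg (of_eventually_lt_succ ?_)
    filter_upwards [h] with n hn
    simp only [Pi.neg_apply]
    linarith [fwdDiff_one_apply s n]

theorem le_succ_or_succ_le {s : ℕ → ℝ} (h : HasEventualSign (fwdDiff 1 s)) :
    (∀ᶠ n in atTop, s n ≤ s (n + 1)) ∨ ∀ᶠ n in atTop, s (n + 1) ≤ s n := by
  rcases h with h | h | h
  · left; filter_upwards [h] with n hn; linarith [fwdDiff_one_apply s n]
  · left; filter_upwards [h] with n hn; linarith [fwdDiff_one_apply s n]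
  · right; filter_upwards [h] with n hn; linarith [fwdDiff_one_apply s n]

/-- An eventually nondecreasing sequence stays below its limit, so it cannot tend to 0 through
positive values. -/
theorem succ_le_of_tendsto_zero {u : ℕ → ℝ} (h : HasEventualSign (fwdDiff 1 u))
    (hlim : Tendsto u atTop (𝓝 0)) (hpos : ∀ᶠ n in atTop, 0 < u n) :
    ∀ᶠ n in atTop, u (n + 1) ≤ u n := by
  rcases h.le_succ_or_succ_le with h | h
  · exfalso
    obtain ⟨N, hN⟩ := exists_monotone_add h
    have h0 := hN.ge_of_tendsto ((tendsto_add_atTop_iff_nat N).2 hlim)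
    obtain ⟨n, hn, hn'⟩ := (hpos.and (eventually_ge_atTop N)).exists
    have := h0 (n - N)
    rw [Nat.sub_add_cancel hn'] at this
    linarith
  · exact h

end HasEventualSign

/-! ### Growth of a sequence and of its differences -/

/-- Discrete integration: C t - s and C t + s are eventually nondecreasing, hence bounded below, and
the divergence of t absorbs the two bounds. -/
theorem isBigO_of_abs_fwdDiff_le {s t : ℕ → ℝ} (C : ℝ)
    (h : ∀ᶠ n in atTop, |s (n + 1) - s n| ≤ C * (t (n + 1) - t n))
    (ht : Tendsto t atTop atTop) : s =O[atTop] t := by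
  obtain ⟨B₁, h₁⟩ := eventually_ge_of_eventually_le_succ (s := fun n => C * t n - s n) (by
    filter_upwards [h] with n hn
    have := abs_le.1 hn
    linarith)
  obtain ⟨B₂, h₂⟩ := eventually_ge_of_eventually_le_succ (s := fun n => C * t n + s n) (by
    filter_upwards [h] with n hn
    have := abs_le.1 hn
    linarith)
  refine IsBigO.of_bound (C + 1) ?_
  filter_upwards [h₁, h₂, ht.eventually_ge_atTop 0, ht.eventually_ge_atTop (-B₁),
    ht.eventually_ge_atTop (-B₂)] with n a b c d e
  rw [Real.norm_eq_abs, Real.norm_eq_abs, abs_of_nonneg c, abs_le]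
  constructor <;> linarith

theorem exists_succ_pow_sub_pow_le (e : ℕ) :
    ∃ K : ℝ, 0 < K ∧ ∀ n : ℕ, 1 ≤ n → ((n + 1 : ℝ)) ^ (e + 1) - (n : ℝ) ^ (e + 1) ≤ K * n ^ e := by
  induction e with
  | zero => exact ⟨1, one_pos, fun n _ => by simp⟩
  | succ e ih =>
    obtain ⟨K, hK, h⟩ := ih
    refine ⟨2 * K + 1, by positivity, fun n hn => ?_⟩
    have h1 := h n hn
    have hn' : (1 : ℝ) ≤ n := by exact_mod_cast hn
    have h2 : (n + 1 : ℝ) * ((n + 1 : ℝ) ^ (e + 1) - (n : ℝ) ^ (e + 1)) ≤ (2 * n) * (K * n ^ e) :=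
      mul_le_mul (by linarith) h1
        (sub_nonneg.2 (pow_le_pow_left₀ (by linarith) (by linarith) _)) (by linarith)
    calc (n + 1 : ℝ) ^ (e + 1 + 1) - (n : ℝ) ^ (e + 1 + 1)
        = (n + 1 : ℝ) * ((n + 1 : ℝ) ^ (e + 1) - (n : ℝ) ^ (e + 1)) + n ^ (e + 1) := by ring
      _ ≤ (2 * n) * (K * n ^ e) + n ^ (e + 1) := by linarith
      _ = _ := by ring

/-- Summing e times a quantity bounded below by a positive constant gives growth at least of order
n^e. Used contrapositively for s = o(n^e). -/
theorem pow_le_of_le_iterate_fwdDiff (e : ℕ) : ∀ (s : ℕ → ℝ) (c : ℝ), 0 < c →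
    (∀ᶠ n in atTop, c ≤ (fwdDiff 1)^[e] s n) →
    ∃ C, 0 < C ∧ ∀ᶠ n : ℕ in atTop, (n : ℝ) ^ e ≤ C * s n := by
  induction e with
  | zero =>
    intro s c hc h
    refine ⟨c⁻¹, by positivity, ?_⟩
    filter_upwards [h] with n hn
    rw [pow_zero, inv_mul_eq_div, le_div_iff₀ hc]
    simpa using hn
  | succ e ih =>
    intro s c hc h
    obtain ⟨C, hC, h1⟩ := ih (fwdDiff 1 s) c hc (by simpa only [Function.iterate_succ_apply] using h)
    obtain ⟨K, hK, hK'⟩ := exists_succ_pow_sub_pow_le e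
    obtain ⟨B, hB⟩ := eventually_ge_of_eventually_le_succ
        (s := fun n => K * C * s n - (n : ℝ) ^ (e + 1)) (by
      filter_upwards [h1, eventually_ge_atTop 1] with n hn h1n
      have h3 := hK' n h1n
      have h4 := mul_le_mul_of_nonneg_left hn hK.le
      rw [fwdDiff_one_apply] at h4
      push_cast
      linarith)
    -- The factor 2 pays for the constant of summation B, which is at least -n^(e+1)/2 for large n.
    refine ⟨2 * (K * C), by positivity, ?_⟩
    have ht : Tendsto (fun n : ℕ => (n : ℝ) ^ (e + 1)) atTop atTop :=
      (tendsto_pow_atTop (Nat.succ_ne_zero e)).comp tendsto_natCast_atTop_atTop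
    filter_upwards [hB, ht.eventually_ge_atTop (-2 * B)] with n a b
    linarith

theorem tendsto_natCast_pow_mul_log (d : ℕ) :
    Tendsto (fun n : ℕ => (n : ℝ) ^ d * Real.log n) atTop atTop := by
  have hl := Real.tendsto_log_atTop.comp (tendsto_natCast_atTop_atTop (R := ℝ))
  refine tendsto_atTop_mono' _ ?_ hl
  filter_upwards [eventually_ge_atTop 1] with n hn
  have hn' : (1 : ℝ) ≤ n := by exact_mod_cast hn
  exact le_mul_of_one_le_left (Real.log_nonneg hn') (one_le_pow₀ hn')

/-- The first summation of 1/n produces the logarithm and each further one a factor n. This is where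
the bound t^d log t comes from: growth beyond it forbids a top difference of size O(1/n). -/
theorem isBigO_pow_mul_log_of_iterate_fwdDiff (d : ℕ) : ∀ s : ℕ → ℝ,
    (fwdDiff 1)^[d + 1] s =O[atTop] (fun n : ℕ => (n : ℝ)⁻¹) →
    s =O[atTop] fun n : ℕ => (n : ℝ) ^ d * Real.log n := by
  induction d with
  | zero =>
    intro s h
    obtain ⟨C, hC, h⟩ := h.exists_pos
    -- The 2 comes from 1/n ≤ 2/(n+1) ≤ 2(log(n+1) - log n).
    refine isBigO_of_abs_fwdDiff_le (2 * C) ?_ (tendsto_natCast_pow_mul_log 0)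
    filter_upwards [h.bound, eventually_ge_atTop 1] with n hn h1
    have hn' : (1 : ℝ) ≤ n := by exact_mod_cast h1
    have hl : ((n : ℝ) + 1)⁻¹ ≤ Real.log (n + 1) - Real.log n := by
      rw [← Real.log_div (by positivity) (by positivity)]
      refine le_trans (le_of_eq ?_) (Real.one_sub_inv_le_log_of_pos (by positivity))
      field_simp
      ring
    have h2 : (n : ℝ)⁻¹ ≤ 2 * ((n : ℝ) + 1)⁻¹ := by
      rw [← div_eq_mul_inv, inv_eq_one_div, div_le_div_iff₀ (by positivity) (by positivity)]
      linarith
    simp only [zero_add, Function.iterate_one, fwdDiff_one_apply, Real.norm_eq_abs, abs_inv,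
      Nat.abs_cast] at hn
    simp only [pow_zero, one_mul]
    push_cast
    calc |s (n + 1) - s n| ≤ C * (n : ℝ)⁻¹ := hn
      _ ≤ C * (2 * ((n : ℝ) + 1)⁻¹) := by gcongr
      _ ≤ C * (2 * (Real.log (n + 1) - Real.log n)) := by gcongr
      _ = _ := by ring
  | succ d ih =>
    intro s h
    have h := ih (fwdDiff 1 s) (by simpa only [Function.iterate_succ_apply] using h)
    obtain ⟨C, hC, h⟩ := h.exists_pos
    refine isBigO_of_abs_fwdDiff_le C ?_ (tendsto_natCast_pow_mul_log (d + 1))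
    filter_upwards [h.bound, eventually_ge_atTop 1] with n hn h1
    have hn' : (1 : ℝ) ≤ n := by exact_mod_cast h1
    have hl0 : 0 ≤ Real.log n := Real.log_nonneg hn'
    rw [Real.norm_eq_abs, Real.norm_eq_abs,
      abs_of_nonneg (show 0 ≤ (n : ℝ) ^ d * Real.log n by positivity), fwdDiff_one_apply] at hn
    refine hn.trans (mul_le_mul_of_nonneg_left ?_ hC.le)
    have hl : Real.log n ≤ Real.log (n + 1) := Real.log_le_log (by linarith) (by linarith)
    have hp : (n : ℝ) ^ d ≤ (n + 1 : ℝ) ^ d := pow_le_pow_left₀ (by linarith) (by linarith) _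
    push_cast
    have h3 : ((n : ℝ) + 1) ^ (d + 1) * Real.log n ≤ (n + 1 : ℝ) ^ (d + 1) * Real.log (n + 1) := by
      gcongr
    have h4 : (n : ℝ) ^ d * (n + 1) * Real.log n ≤ (n + 1 : ℝ) ^ (d + 1) * Real.log n := by
      rw [pow_succ]; gcongr
    have h5 : (n : ℝ) ^ d * (n + 1) * Real.log n
        = (n : ℝ) ^ d * Real.log n + (n : ℝ) ^ (d + 1) * Real.log n := by ring
    linarith

/-! ### Fields of sequences -/

/-- A set of real sequences that is a field up to eventual equality, is closed under the shift, and
all of whose members are eventually of constant sign. -/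
structure IsSequenceField (F : Set (ℕ → ℝ)) : Prop where
  one_mem : 1 ∈ F
  add_mem : ∀ s ∈ F, ∀ t ∈ F, s + t ∈ F
  neg_mem : ∀ s ∈ F, -s ∈ F
  mul_mem : ∀ s ∈ F, ∀ t ∈ F, s * t ∈ F
  shift_mem : ∀ s ∈ F, (fun n => s (n + 1)) ∈ F
  exists_inv : ∀ s ∈ F, (¬ ∀ᶠ n in atTop, s n = 0) → ∃ t ∈ F, ∀ᶠ n in atTop, s n * t n = 1
  sign : ∀ s ∈ F, HasEventualSign s

namespace IsSequenceField

variable {F : Set (ℕ → ℝ)} (hF : IsSequenceField F)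
include hF

theorem sub_mem {s t : ℕ → ℝ} (hs : s ∈ F) (ht : t ∈ F) : s - t ∈ F := by
  rw [sub_eq_add_neg]
  exact hF.add_mem _ hs _ (hF.neg_mem _ ht)

theorem fwdDiff_mem {s : ℕ → ℝ} (hs : s ∈ F) : fwdDiff 1 s ∈ F :=
  hF.sub_mem (hF.shift_mem s hs) hs

theorem iterate_fwdDiff_mem {s : ℕ → ℝ} (hs : s ∈ F) (k : ℕ) : (fwdDiff 1)^[k] s ∈ F := by
  induction k with
  | zero => exact hs
  | succ k ih => rw [Function.iterate_succ_apply']; exact hF.fwdDiff_mem ih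

theorem natCast_mem (k : ℕ) : (fun _ => (k : ℝ)) ∈ F := by
  induction k with
  | zero =>
    have h := hF.sub_mem hF.one_mem hF.one_mem
    rw [sub_self] at h
    simpa using! h
  | succ k ih =>
    have h := hF.add_mem _ ih _ hF.one_mem
    convert h using 1
    ext n
    simp

/-- A linear combination of two members of a sequence field is eventually of constant sign. -/
theorem sign_add_mul {s t : ℕ → ℝ} (hs : s ∈ F) (ht : t ∈ F) (α : ℝ) :
    HasEventualSign (fun n => s n + α * t n) := by
  by_cases h0 : ∀ᶠ n in atTop, t n = 0
  · exact (hF.sign s hs).congr (by filter_upwards [h0] with n hn; simp [hn])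
  · obtain ⟨r, hr, htr⟩ := hF.exists_inv t ht h0
    -- Write s + αt = t (s/t + α). Differencing the second factor removes α, so α itself need not
    -- belong to the field.
    have h1 : HasEventualSign (fun n => s n * r n + α) := by
      refine HasEventualSign.of_fwdDiff ?_
      refine (hF.sign _ (hF.fwdDiff_mem (hF.mul_mem s hs r hr))).congr (Eventually.of_forall ?_)
      intro n
      simp [fwdDiff_one_apply]
    refine ((hF.sign t ht).mul h1).congr ?_
    filter_upwards [htr] with n hn
    simp only [Pi.mul_apply]
    linear_combination s n * hn

/-- Arbitrary real constants need not lie in the field, so sequences are compared only with 1/k, by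
means of k s - 1. -/
theorem natCast_mul_sub_one_sign {s : ℕ → ℝ} (hs : s ∈ F) (k : ℕ) :
    (∀ᶠ n in atTop, 1 < k * s n) ∨ ∀ᶠ n in atTop, k * s n ≤ 1 := by
  rcases hF.sign _ (hF.sub_mem (hF.mul_mem _ (hF.natCast_mem k) s hs) hF.one_mem) with h | h | h
  · left; filter_upwards [h] with n hn; simpa using hn
  · right; filter_upwards [h] with n hn; simp at hn; linarith
  · right; filter_upwards [h] with n hn; simp at hn; linarith

theorem eventually_natCast_mul_iterate_fwdDiff_le_one {s : ℕ → ℝ} (hs : s ∈ F) {e : ℕ}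
    (hup : s =o[atTop] fun n : ℕ => (n : ℝ) ^ e) (k : ℕ) :
    ∀ᶠ n in atTop, k * (fwdDiff 1)^[e] s n ≤ 1 := by
  rcases hF.natCast_mul_sub_one_sign (hF.iterate_fwdDiff_mem hs e) k with h | h
  swap
  · exact h
  exfalso
  have hk : (0 : ℝ) < k := by
    obtain ⟨n, hn⟩ := h.exists
    rcases Nat.eq_zero_or_pos k with rfl | hk
    · norm_num at hn
    · exact_mod_cast hk
  obtain ⟨C, hC, h1⟩ := pow_le_of_le_iterate_fwdDiff e s (k : ℝ)⁻¹ (by positivity) (by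
    filter_upwards [h] with n hn
    rw [inv_le_iff_one_le_mul₀' hk]
    exact hn.le)
  have h2 := hup.bound (c := (2 * C)⁻¹) (by positivity)
  obtain ⟨n, h1, h2, hn⟩ := (h1.and (h2.and (eventually_ge_atTop 1))).exists
  have hn' : (1 : ℝ) ≤ n := by exact_mod_cast hn
  have hp : (0 : ℝ) < (n : ℝ) ^ e := by positivity
  rw [Real.norm_eq_abs, Real.norm_eq_abs, abs_of_nonneg hp.le] at h2
  have h3 : C * s n ≤ C * ((2 * C)⁻¹ * (n : ℝ) ^ e) :=
    mul_le_mul_of_nonneg_left ((le_abs_self _).trans h2) hC.le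
  have h4 : C * ((2 * C)⁻¹ * (n : ℝ) ^ e) = (n : ℝ) ^ e / 2 := by field_simp
  linarith

theorem tendsto_iterate_fwdDiff {s : ℕ → ℝ} (hs : s ∈ F) {e : ℕ}
    (hup : s =o[atTop] fun n : ℕ => (n : ℝ) ^ e) :
    Tendsto ((fwdDiff 1)^[e] s) atTop (𝓝 0) := by
  rw [Metric.tendsto_nhds]
  intro ε hε
  obtain ⟨k, hk⟩ := exists_nat_gt ε⁻¹
  have hk0 : (0 : ℝ) < k := (inv_pos.2 hε).trans hk
  have h2 := hF.eventually_natCast_mul_iterate_fwdDiff_le_one (hF.neg_mem s hs) hup.neg_left k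
  have hneg : (fwdDiff 1)^[e] (-s) = -(fwdDiff 1)^[e] s := by
    have := fwdDiff_iter_const_smul (1 : ℕ) (-1 : ℝ) s e
    simpa using! this
  rw [hneg] at h2
  filter_upwards [hF.eventually_natCast_mul_iterate_fwdDiff_le_one hs hup k, h2] with n h1 h2
  rw [Real.dist_eq, sub_zero]
  have h3 : k * |(fwdDiff 1)^[e] s n| ≤ 1 := by
    rcases abs_cases ((fwdDiff 1)^[e] s n) with ⟨h, -⟩ | ⟨h, -⟩ <;> rw [h]
    · exact h1
    · simpa using h2
  have h4 : 1 < k * ε := by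
    rwa [inv_lt_iff_one_lt_mul₀ hε] at hk
  exact lt_of_mul_lt_mul_left (h3.trans_lt h4) hk0.le

/-- The sequence n need not lie in the field. Factor Δ(n u) = Δu · (n + u(n+1)/Δu); the difference
of the second factor is 1 + Δ(u(n+1)/Δu), which does lie in it. -/
theorem fwdDiff_natCast_mul_sign {u : ℕ → ℝ} (hu : u ∈ F) :
    HasEventualSign (fwdDiff 1 fun n : ℕ => (n : ℝ) * u n) := by
  have hd : ∀ n, fwdDiff 1 (fun n : ℕ => (n : ℝ) * u n) n
      = n * fwdDiff 1 u n + u (n + 1) := by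
    intro n
    simp only [fwdDiff_one_apply]
    push_cast
    ring
  have hu1 := hF.shift_mem u hu
  by_cases h0 : ∀ᶠ n in atTop, fwdDiff 1 u n = 0
  · refine (hF.sign _ hu1).congr ?_
    filter_upwards [h0] with n hn
    rw [hd, hn, mul_zero, zero_add]
  · obtain ⟨r, hr, hur⟩ := hF.exists_inv _ (hF.fwdDiff_mem hu) h0
    have hw := hF.fwdDiff_mem (hF.mul_mem _ hu1 r hr)
    have h1 : HasEventualSign (fun n : ℕ => (n : ℝ) + u (n + 1) * r n) := by
      refine HasEventualSign.of_fwdDiff ?_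
      refine (hF.sign _ (hF.add_mem _ hF.one_mem _ hw)).congr (Eventually.of_forall ?_)
      intro n
      simp [fwdDiff_one_apply]
      ring
    refine ((hF.sign _ (hF.fwdDiff_mem hu)).mul h1).congr ?_
    filter_upwards [hur] with n hn
    rw [hd, Pi.mul_apply]
    linear_combination u (n + 1) * hn

/-- A member of a sequence field that tends to zero through positive values, but is not `O(1 / n)`,
varies slowly. -/
theorem slow_of_eventually_pos {u : ℕ → ℝ} (hu : u ∈ F) (hlim : Tendsto u atTop (𝓝 0))
    (hlow : ¬ u =O[atTop] fun n : ℕ => (n : ℝ)⁻¹) (hpos : ∀ᶠ n in atTop, 0 < u n) :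
    Tendsto (fun n : ℕ => (n : ℝ) * u n) atTop atTop ∧ fwdDiff 1 u =o[atTop] u := by
  have hnb : ∀ B : ℝ, ¬ ∀ᶠ n : ℕ in atTop, (n : ℝ) * u n ≤ B := by
    intro B hB
    refine hlow (IsBigO.of_bound B ?_)
    filter_upwards [hB, hpos, eventually_gt_atTop 0] with n h1 h2 h3
    have h3' : (0 : ℝ) < n := by exact_mod_cast h3
    rw [Real.norm_eq_abs, Real.norm_eq_abs, abs_of_pos h2, abs_of_pos (by positivity),
      ← div_eq_mul_inv, le_div_iff₀ h3']
    linarith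
  -- The sequence n u(n) is eventually monotone; were it nonincreasing, it would be bounded above
  -- and u would be O(1/n).
  have hmono : ∀ᶠ n : ℕ in atTop, (n : ℝ) * u n ≤ ((n + 1 : ℕ) : ℝ) * u (n + 1) := by
    rcases (hF.fwdDiff_natCast_mul_sign hu).le_succ_or_succ_le with h | h
    · exact h
    · exfalso
      obtain ⟨B, hB⟩ := eventually_ge_of_eventually_le_succ (s := fun n : ℕ => -((n : ℝ) * u n))
        (by filter_upwards [h] with n hn; linarith)
      exact hnb (-B) (by filter_upwards [hB] with n hn; linarith)
  have hanti := (hF.sign _ (hF.fwdDiff_mem hu)).succ_le_of_tendsto_zero hlim hpos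
  constructor
  · obtain ⟨N, hN⟩ := exists_monotone_add hmono
    rcases tendsto_atTop_of_monotone hN with h | ⟨l, h⟩
    · exact (tendsto_add_atTop_iff_nat (f := fun n : ℕ => (n : ℝ) * u n) N).1 h
    · exfalso
      have h := (tendsto_add_atTop_iff_nat (f := fun n : ℕ => (n : ℝ) * u n) N).1 h
      exact hnb (l + 1) (h.eventually_le_const (lt_add_one l))
  · refine IsLittleO.of_bound fun c hc => ?_
    filter_upwards [hmono, hanti, hpos, tendsto_natCast_atTop_atTop.eventually_ge_atTop c⁻¹]
      with n h1 h2 h3 h4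
    rw [Real.norm_eq_abs, Real.norm_eq_abs, abs_of_pos h3, fwdDiff_one_apply,
      abs_of_nonpos (by linarith)]
    have hn : (0 : ℝ) < n := (inv_pos.2 hc).trans_le h4
    push_cast at h1
    have h5 : 1 ≤ c * n := by rwa [inv_le_iff_one_le_mul₀' hc] at h4
    -- Monotonicity of n u(n) bounds the left side by u(n+1) ≤ u(n), so |Δu| ≤ u/n.
    have h6 : (n : ℝ) * (u n - u (n + 1)) ≤ u n := by nlinarith
    have h7 : u n ≤ (c * n) * u n := le_mul_of_one_le_left h3.le h5
    refine le_of_mul_le_mul_left ?_ hn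
    linarith

theorem slow {u : ℕ → ℝ} (hu : u ∈ F) (hlim : Tendsto u atTop (𝓝 0))
    (hlow : ¬ u =O[atTop] fun n : ℕ => (n : ℝ)⁻¹) :
    Tendsto (fun n : ℕ => (n : ℝ) * |u n|) atTop atTop ∧ fwdDiff 1 u =o[atTop] u := by
  rcases hF.sign u hu with h | h | h
  · obtain ⟨h1, h2⟩ := hF.slow_of_eventually_pos hu hlim hlow h
    refine ⟨h1.congr' ?_, h2⟩
    filter_upwards [h] with n hn
    rw [abs_of_pos hn]
  · exact absurd ((isBigO_zero _ _).congr' (EventuallyEq.symm h) EventuallyEq.rfl) hlow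
  · obtain ⟨h1, h2⟩ := hF.slow_of_eventually_pos (hF.neg_mem u hu) (by simpa using! hlim.neg)
      (fun h => hlow (isBigO_neg_left.1 h)) (by filter_upwards [h] with n hn; simpa using hn)
    refine ⟨h1.congr' ?_, ?_⟩
    · filter_upwards [h] with n hn
      rw [abs_of_neg hn, Pi.neg_apply]
    · have hneg : fwdDiff 1 (-u) = fun n => -fwdDiff 1 u n := by
        ext n
        simp [fwdDiff_one_apply]
        ring
      rw [hneg] at h2
      exact isLittleO_neg_right.1 (isLittleO_neg_left.1 h2)

/-- The top differences of a member of a sequence field which grows strictly between `n ^ d log n`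
and `n ^ (d + 1)`. -/
theorem slow_iterate_fwdDiff {s : ℕ → ℝ} (hs : s ∈ F) (d : ℕ)
    (hlow : (fun n : ℕ => (n : ℝ) ^ d * Real.log n) =o[atTop] s)
    (hup : s =o[atTop] fun n : ℕ => (n : ℝ) ^ (d + 1)) :
    Tendsto ((fwdDiff 1)^[d + 1] s) atTop (𝓝 0) ∧
      Tendsto (fun n : ℕ => (n : ℝ) * |(fwdDiff 1)^[d + 1] s n|) atTop atTop ∧
      fwdDiff 1 ((fwdDiff 1)^[d + 1] s) =o[atTop] (fwdDiff 1)^[d + 1] s := by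
  have h0 := hF.tendsto_iterate_fwdDiff hs hup
  refine ⟨h0, hF.slow (hF.iterate_fwdDiff_mem hs _) h0 fun h => ?_⟩
  -- If the top difference were O(1/n), then n^d log n would be negligible against itself.
  have h1 := hlow.trans_isBigO (isBigO_pow_mul_log_of_iterate_fwdDiff d s h)
  refine isLittleO_irrefl ?_ h1
  refine ((tendsto_natCast_pow_mul_log d).eventually_gt_atTop 0).frequently.mono fun n hn => ?_
  exact hn.ne'

end IsSequenceField

/-! ### Cesàro means -/

/-- The mean of the first `N` terms of a complex sequence. -/
noncomputable def cesaroMean (x : ℕ → ℂ) (N : ℕ) : ℂ := (N : ℂ)⁻¹ * ∑ n ∈ Finset.range N, x n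

theorem tendsto_cesaroMean {x : ℕ → ℂ} {L : ℂ} (h : Tendsto x atTop (𝓝 L)) :
    Tendsto (cesaroMean x) atTop (𝓝 L) := by
  refine h.cesaro_smul.congr fun N => ?_
  simp [cesaroMean]

theorem cesaroMean_sub (x y : ℕ → ℂ) (N : ℕ) :
    cesaroMean (x - y) N = cesaroMean x N - cesaroMean y N := by
  simp [cesaroMean, Finset.sum_sub_distrib, mul_sub]

theorem cesaroMean_const_mul (c : ℂ) (x : ℕ → ℂ) (N : ℕ) :
    cesaroMean (fun n => c * x n) N = c * cesaroMean x N := by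
  simp only [cesaroMean, ← Finset.mul_sum]
  ring

theorem cesaroMean_sum {ι : Type*} (s : Finset ι) (x : ι → ℕ → ℂ) (N : ℕ) :
    cesaroMean (fun n => ∑ i ∈ s, x i n) N = ∑ i ∈ s, cesaroMean (x i) N := by
  simp only [cesaroMean, Finset.mul_sum]
  exact Finset.sum_comm

theorem tendsto_cesaroMean_of_sub {x y : ℕ → ℂ} {L : ℂ} (hy : Tendsto (cesaroMean y) atTop (𝓝 L))
    (h : Tendsto (x - y) atTop (𝓝 0)) : Tendsto (cesaroMean x) atTop (𝓝 L) := by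
  have := (tendsto_cesaroMean h).add hy
  rw [zero_add] at this
  exact this.congr fun N => by rw [cesaroMean_sub]; ring

theorem norm_cesaroMean_le {x : ℕ → ℂ} {C : ℝ} (hC : 0 ≤ C) (h : ∀ n, ‖x n‖ ≤ C) (N : ℕ) :
    ‖cesaroMean x N‖ ≤ C := by
  rcases Nat.eq_zero_or_pos N with rfl | hN
  · simpa [cesaroMean] using hC
  · have hN' : (0 : ℝ) < N := by exact_mod_cast hN
    rw [cesaroMean, norm_mul, norm_inv, Complex.norm_natCast, inv_mul_le_iff₀ hN']
    exact (norm_sum_le_of_le _ fun n _ => h n).trans (by simp)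

theorem tendsto_cesaroMean_shift_sub {x : ℕ → ℂ} {C : ℝ} (hC : ∀ n, ‖x n‖ ≤ C) (h : ℕ) :
    Tendsto (fun N => cesaroMean (fun n => x (n + h)) N - cesaroMean x N) atTop (𝓝 0) := by
  induction h with
  | zero => simp
  | succ h ih =>
    have h1 : Tendsto (fun N => cesaroMean (fun n => x (n + (h + 1))) N
        - cesaroMean (fun n => x (n + h)) N) atTop (𝓝 0) := by
      refine squeeze_zero_norm (a := fun N : ℕ => (2 * C) * (N : ℝ)⁻¹) (fun N => ?_) ?_
      · have h2 := Finset.sum_range_sub (fun n => x (n + h)) N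
        rw [← cesaroMean_sub, cesaroMean, norm_mul, norm_inv, Complex.norm_natCast, mul_comm]
        refine mul_le_mul_of_nonneg_right ?_ (by positivity)
        have h3 : ∑ n ∈ Finset.range N, ((fun n => x (n + (h + 1))) - fun n => x (n + h)) n
            = x (N + h) - x (0 + h) := by
          rw [← h2]
          refine Finset.sum_congr rfl fun n _ => ?_
          simp only [Pi.sub_apply]
          rw [show n + (h + 1) = n + 1 + h by omega]
        rw [h3]
        exact (norm_sub_le _ _).trans (by linarith [hC (N + h), hC (0 + h)])
      · simpa using tendsto_natCast_atTop_atTop.inv_tendsto_atTop.const_mul (2 * C)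
    have := h1.add ih
    rw [zero_add] at this
    exact this.congr fun N => by ring

theorem tendsto_cesaroMean_shift {x : ℕ → ℂ} {C : ℝ} (hC : ∀ n, ‖x n‖ ≤ C) {L : ℂ}
    (hx : Tendsto (cesaroMean x) atTop (𝓝 L)) (h : ℕ) :
    Tendsto (cesaroMean fun n => x (n + h)) atTop (𝓝 L) := by
  have := (tendsto_cesaroMean_shift_sub hC h).add hx
  rw [zero_add] at this
  exact this.congr fun N => by ring

theorem cesaroMean_conj (x : ℕ → ℂ) (N : ℕ) :
    cesaroMean (fun n => (starRingEnd ℂ) (x n)) N = (starRingEnd ℂ) (cesaroMean x N) := by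
  simp [cesaroMean]

theorem tendsto_cesaroMean_conj {x : ℕ → ℂ} (h : Tendsto (cesaroMean x) atTop (𝓝 0)) :
    Tendsto (cesaroMean fun n => (starRingEnd ℂ) (x n)) atTop (𝓝 0) := by
  have := (Complex.continuous_conj.tendsto 0).comp h
  rw [map_zero] at this
  exact this.congr fun N => (cesaroMean_conj x N).symm

theorem norm_cesaroMean_sq_le (x : ℕ → ℂ) (N : ℕ) :
    ‖cesaroMean x N‖ ^ 2 ≤ ‖cesaroMean (fun n => ((‖x n‖ ^ 2 : ℝ) : ℂ)) N‖ := by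
  rcases Nat.eq_zero_or_pos N with rfl | hN
  · simp [cesaroMean]
  have hN' : (0 : ℝ) < N := by exact_mod_cast hN
  have h1 : ‖∑ n ∈ Finset.range N, x n‖ ^ 2 ≤ N * ∑ n ∈ Finset.range N, ‖x n‖ ^ 2 := by
    refine (pow_le_pow_left₀ (norm_nonneg _) (norm_sum_le _ _) 2).trans ?_
    simpa using sq_sum_le_card_mul_sum_sq (s := Finset.range N) (f := fun n => ‖x n‖)
  simp only [cesaroMean]
  rw [← Complex.ofReal_sum, norm_mul, norm_mul, norm_inv, Complex.norm_natCast, mul_pow,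
    Complex.norm_of_nonneg (Finset.sum_nonneg fun _ _ => by positivity)]
  calc ((N : ℝ)⁻¹) ^ 2 * ‖∑ n ∈ Finset.range N, x n‖ ^ 2
      ≤ ((N : ℝ)⁻¹) ^ 2 * (N * ∑ n ∈ Finset.range N, ‖x n‖ ^ 2) := by gcongr
    _ = (N : ℝ)⁻¹ * ∑ n ∈ Finset.range N, ‖x n‖ ^ 2 := by field_simp

/-- Van der Corput's difference theorem for a sequence of complex numbers of modulus one. -/
theorem tendsto_cesaroMean_of_correlations {x : ℕ → ℂ} (hx : ∀ n, ‖x n‖ = 1)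
    (hcor : ∀ h, 1 ≤ h →
      Tendsto (cesaroMean fun n => x (n + h) * (starRingEnd ℂ) (x n)) atTop (𝓝 0)) :
    Tendsto (cesaroMean x) atTop (𝓝 0) := by
  have hlt : ∀ j k, j < k → Tendsto
      (cesaroMean fun n => x (n + k) * (starRingEnd ℂ) (x (n + j))) atTop (𝓝 0) := by
    intro j k hjk
    have h1 := tendsto_cesaroMean_shift (C := 1) (fun n => by simp [hx]) (hcor (k - j) (by omega)) j
    refine h1.congr fun N => ?_
    simp only [show ∀ n, n + j + (k - j) = n + k by omega]
  have hpair : ∀ j k, Tendsto (cesaroMean fun n => x (n + k) * (starRingEnd ℂ) (x (n + j))) atTop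
      (𝓝 (if k = j then 1 else 0)) := by
    intro j k
    rcases lt_trichotomy j k with h | rfl | h
    · simpa [h.ne'] using hlt j k h
    · refine tendsto_cesaroMean ?_
      simp [Complex.mul_conj, Complex.normSq_eq_norm_sq, hx]
    · rw [if_neg h.ne]
      refine (tendsto_cesaroMean_conj (hlt k j h)).congr fun N => ?_
      congr 1
      ext n
      simp [mul_comm]
  -- Replacing x by its averages A over windows of length H does not change the limiting mean. When
  -- |A|² is expanded only the diagonal terms survive, so its mean tends to 1/H, and Cauchy–Schwarz
  -- applies.
  have hblock : ∀ H : ℕ, 1 ≤ H → ∀ᶠ N in atTop, ‖cesaroMean x N‖ ≤ 2 * √(2 / H) := by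
    intro H hH
    have hH' : (0 : ℝ) < H := by exact_mod_cast hH
    have hHc : (H : ℂ) ≠ 0 := by exact_mod_cast hH'.ne'
    set A : ℕ → ℂ := fun n => (H : ℂ)⁻¹ * ∑ j ∈ Finset.range H, x (n + j) with hA
    have hA1 : Tendsto (fun N => cesaroMean A N - cesaroMean x N) atTop (𝓝 0) := by
      have h1 := (tendsto_finsetSum (Finset.range H) fun j _ =>
        tendsto_cesaroMean_shift_sub (fun n => (hx n).le) j).const_mul (H : ℂ)⁻¹
      simp only [Finset.sum_const_zero, mul_zero] at h1
      refine h1.congr fun N => ?_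
      rw [hA, cesaroMean_const_mul, cesaroMean_sum, Finset.sum_sub_distrib, mul_sub]
      simp [hHc]
    have hA2 : Tendsto (cesaroMean fun n => ((‖A n‖ ^ 2 : ℝ) : ℂ)) atTop (𝓝 ((H : ℂ)⁻¹)) := by
      have h1 := (tendsto_finsetSum (Finset.range H) fun k _ =>
        tendsto_finsetSum (Finset.range H) fun j _ => hpair j k).const_mul (((H : ℂ)⁻¹) ^ 2)
      have h2 : ((H : ℂ)⁻¹) ^ 2 *
          ∑ k ∈ Finset.range H, ∑ j ∈ Finset.range H, (if k = j then (1 : ℂ) else 0)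
          = (H : ℂ)⁻¹ := by
        have h3 : ∑ k ∈ Finset.range H, ∑ j ∈ Finset.range H, (if k = j then (1 : ℂ) else 0) = H := by
          rw [Finset.sum_congr rfl fun k hk => by rw [Finset.sum_ite_eq, if_pos hk]]
          simp
        rw [h3]
        field_simp
      rw [h2] at h1
      refine h1.congr fun N => ?_
      simp only [← cesaroMean_sum]
      rw [← cesaroMean_const_mul]
      congr 1
      ext n
      rw [hA, Complex.ofReal_pow, ← Complex.mul_conj', map_mul, map_sum, map_inv₀,
        Complex.conj_natCast]
      rw [show ∀ a b c : ℂ, a * b * (a * c) = a ^ 2 * (b * c) by intros; ring, Finset.sum_mul_sum]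
    have hA3 : ∀ᶠ N in atTop, ‖cesaroMean A N‖ ≤ √(2 / H) := by
      have h1 : ‖(H : ℂ)⁻¹‖ < 2 / H := by
        rw [norm_inv, Complex.norm_natCast, inv_eq_one_div]
        gcongr
        norm_num
      filter_upwards [hA2.norm.eventually_le_const h1] with N hN
      exact Real.le_sqrt_of_sq_le ((norm_cesaroMean_sq_le A N).trans hN)
    have hsq : 0 < √(2 / (H : ℝ)) := Real.sqrt_pos.2 (by positivity)
    have hA4 := (tendsto_zero_iff_norm_tendsto_zero.1 hA1).eventually_le_const hsq
    filter_upwards [hA3, hA4] with N h1 h2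
    calc ‖cesaroMean x N‖ = ‖cesaroMean A N - (cesaroMean A N - cesaroMean x N)‖ := by
          rw [sub_sub_cancel]
      _ ≤ _ := (norm_sub_le _ _).trans (by linarith)
  have hto : Tendsto (fun H : ℕ => 2 * √(2 / (H : ℝ))) atTop (𝓝 0) := by
    have h1 : Tendsto (fun H : ℕ => (2 : ℝ) / H) atTop (𝓝 0) := tendsto_const_div_atTop_nhds_zero_nat 2
    have h2 := ((Real.continuous_sqrt.tendsto 0).comp h1).const_mul 2
    simpa using h2
  rw [Metric.tendsto_nhds]
  intro ε hε
  obtain ⟨H, hH, hH1⟩ := ((hto.eventually_lt_const hε).and (eventually_ge_atTop 1)).exists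
  filter_upwards [hblock H hH1] with N hN
  rw [dist_zero_right]
  exact hN.trans_lt hH

/-- Summation by parts. With the boundary term r(N) x(N) subtracted, each step of the induction
costs only r(N+1) - r(N), and these costs telescope. -/
theorem norm_sum_mul_sub_le {x : ℕ → ℂ} (hx : ∀ n, ‖x n‖ = 1) {r : ℕ → ℝ} (hr : Monotone r)
    (h0 : 0 ≤ r 0) (N : ℕ) :
    ‖∑ n ∈ Finset.range N, (r n : ℂ) * (x (n + 1) - x n)‖ ≤ 2 * r N := by
  have hnn : ∀ n, 0 ≤ r n := fun n => h0.trans (hr (Nat.zero_le n))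
  have key : ‖∑ n ∈ Finset.range N, (r n : ℂ) * (x (n + 1) - x n) - r N * x N‖ ≤ r N := by
    induction N with
    | zero => simp [hx, abs_of_nonneg h0]
    | succ N ih =>
      rw [Finset.sum_range_succ]
      have h1 : ∑ n ∈ Finset.range N, (r n : ℂ) * (x (n + 1) - x n) + r N * (x (N + 1) - x N)
          - r (N + 1) * x (N + 1)
          = (∑ n ∈ Finset.range N, (r n : ℂ) * (x (n + 1) - x n) - r N * x N)
            - ((r (N + 1) - r N : ℝ) : ℂ) * x (N + 1) := by
        push_cast
        ring
      rw [h1]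
      refine (norm_sub_le _ _).trans ?_
      rw [norm_mul, hx, mul_one, Complex.norm_of_nonneg (sub_nonneg.2 (hr (Nat.le_succ N)))]
      linarith
  have h2 : ‖(r N : ℂ) * x N‖ = r N := by
    rw [norm_mul, hx, mul_one, Complex.norm_of_nonneg (hnn N)]
  calc ‖∑ n ∈ Finset.range N, (r n : ℂ) * (x (n + 1) - x n)‖
      = ‖(∑ n ∈ Finset.range N, (r n : ℂ) * (x (n + 1) - x n) - r N * x N) + r N * x N‖ := by
        rw [sub_add_cancel]
    _ ≤ _ := (norm_add_le _ _).trans (by linarith)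

/-! ### Exponential sums -/

/-- The character `t ↦ exp (2 π i t)` of the real line. -/
noncomputable def unitExp (t : ℝ) : ℂ := Complex.exp (2 * Real.pi * Complex.I * t)

theorem unitExp_add (s t : ℝ) : unitExp (s + t) = unitExp s * unitExp t := by
  rw [unitExp, unitExp, unitExp, ← Complex.exp_add]
  push_cast
  ring_nf

theorem norm_unitExp (t : ℝ) : ‖unitExp t‖ = 1 := by
  rw [unitExp, show (2 * Real.pi * Complex.I * t : ℂ) = ((2 * Real.pi * t : ℝ) : ℂ) * Complex.I by
    push_cast; ring]
  exact Complex.norm_exp_ofReal_mul_I _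

theorem conj_unitExp (t : ℝ) : (starRingEnd ℂ) (unitExp t) = unitExp (-t) := by
  rw [unitExp, unitExp, ← Complex.exp_conj]
  simp [map_ofNat]

theorem norm_unitExp_sub_one_sub_le {t : ℝ} (ht : |t| ≤ (2 * Real.pi)⁻¹) :
    ‖unitExp t - 1 - 2 * Real.pi * Complex.I * t‖ ≤ (2 * Real.pi) ^ 2 * t ^ 2 := by
  have hpi : 0 < 2 * Real.pi := by positivity
  have hn : ‖(2 * Real.pi * Complex.I * t : ℂ)‖ = 2 * Real.pi * |t| := by
    simp [abs_of_pos Real.pi_pos]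
  have := Complex.norm_exp_sub_one_sub_id_le (x := 2 * Real.pi * Complex.I * t) (by
    rw [hn]
    calc 2 * Real.pi * |t| ≤ 2 * Real.pi * (2 * Real.pi)⁻¹ := by gcongr
      _ = 1 := mul_inv_cancel₀ hpi.ne')
  rw [hn, mul_pow, sq_abs] at this
  exact this

/-- Fejér's theorem for increasing sequences. -/
theorem tendsto_cesaroMean_unitExp_of_pos {g : ℕ → ℝ} (hlim : Tendsto (fwdDiff 1 g) atTop (𝓝 0))
    (hinf : Tendsto (fun n : ℕ => (n : ℝ) * fwdDiff 1 g n) atTop atTop)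
    (hpos : ∀ᶠ n in atTop, 0 < fwdDiff 1 g n)
    (hanti : ∀ᶠ n in atTop, fwdDiff 1 g (n + 1) ≤ fwdDiff 1 g n) :
    Tendsto (cesaroMean fun n => unitExp (g n)) atTop (𝓝 0) := by
  set δ := fwdDiff 1 g with hδ
  obtain ⟨N₀, hN₀⟩ := eventually_atTop.1 (hpos.and hanti)
  -- Since x(n+1) - x(n) ≈ 2πi δ(n) x(n), the sequence x is approximated by weighted differences of
  -- itself with weights 1/δ. Setting the weights to 0 before N₀ makes them monotone from the start.
  set r : ℕ → ℝ := fun n => if n < N₀ then 0 else (δ n)⁻¹ with hr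
  have hrmono : Monotone r := by
    refine monotone_nat_of_le_succ fun n => ?_
    rcases lt_or_ge n N₀ with h | h
    · simp only [hr, if_pos h]
      split_ifs with h'
      · exact le_rfl
      · exact (inv_pos.2 (hN₀ _ (not_lt.1 h')).1).le
    · simp only [hr, if_neg (not_lt.2 h), if_neg (not_lt.2 (h.trans n.le_succ))]
      exact inv_anti₀ (hN₀ _ (by omega)).1 (hN₀ n h).2
  have hr0 : 0 ≤ r 0 := by
    simp only [hr]
    split_ifs with h'
    · exact le_rfl
    · exact (inv_pos.2 (hN₀ _ (not_lt.1 h')).1).le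
  set x : ℕ → ℂ := fun n => unitExp (g n) with hx
  have hmean : Tendsto (cesaroMean fun n => (r n : ℂ) * (x (n + 1) - x n)) atTop (𝓝 0) := by
    refine squeeze_zero_norm' (a := fun N : ℕ => 2 * ((N : ℝ) * δ N)⁻¹) ?_ ?_
    · filter_upwards [eventually_ge_atTop N₀] with N hN
      have h1 := norm_sum_mul_sub_le (x := x) (fun n => norm_unitExp _) hrmono hr0 N
      rw [cesaroMean, norm_mul, norm_inv, Complex.norm_natCast]
      refine (mul_le_mul_of_nonneg_left h1 (by positivity)).trans (le_of_eq ?_)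
      simp only [hr, if_neg (not_lt.2 hN)]
      rw [mul_inv]
      ring
    · simpa using hinf.inv_tendsto_atTop.const_mul 2
  have hmean' : Tendsto (cesaroMean fun n => (2 * Real.pi * Complex.I)⁻¹ *
      ((r n : ℂ) * (x (n + 1) - x n))) atTop (𝓝 0) := by
    have := hmean.const_mul (2 * Real.pi * Complex.I)⁻¹
    rw [mul_zero] at this
    exact this.congr fun N => (cesaroMean_const_mul _ _ N).symm
  -- The approximation error is second order in δ divided by δ, hence O(δ), and so tends to 0.
  refine tendsto_cesaroMean_of_sub hmean' ?_
  have hpi : (0 : ℝ) < 2 * Real.pi := by positivity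
  refine squeeze_zero_norm' (a := fun n => 2 * Real.pi * δ n) ?_ (by simpa using hlim.const_mul _)
  filter_upwards [eventually_ge_atTop N₀, hlim.eventually_le_const (inv_pos.2 hpi)] with n hn h1
  have hd := (hN₀ n hn).1
  have hxs : x (n + 1) = x n * unitExp (δ n) := by
    simp only [hx, ← unitExp_add, hδ, fwdDiff_one_apply]
    congr 1
    ring
  have h2 := norm_unitExp_sub_one_sub_le (t := δ n) (by rwa [abs_of_pos hd])
  have hdc : (δ n : ℂ) ≠ 0 := by exact_mod_cast hd.ne'
  have hpc : (Real.pi : ℂ) ≠ 0 := by exact_mod_cast Real.pi_ne_zero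
  have h3 : (x - fun n => (2 * Real.pi * Complex.I)⁻¹ * ((r n : ℂ) * (x (n + 1) - x n))) n
      = -((2 * Real.pi * Complex.I)⁻¹ * (δ n : ℂ)⁻¹ * x n) *
        (unitExp (δ n) - 1 - 2 * Real.pi * Complex.I * δ n) := by
    simp only [Pi.sub_apply, hxs, hr, if_neg (not_lt.2 hn)]
    push_cast
    field_simp
    ring
  rw [h3, norm_mul, norm_neg, norm_mul, norm_mul, norm_inv, norm_inv,
    Complex.norm_of_nonneg hd.le]
  have h4 : ‖(2 * Real.pi * Complex.I : ℂ)‖ = 2 * Real.pi := by simp [abs_of_pos Real.pi_pos]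
  rw [h4, show ‖x n‖ = 1 from norm_unitExp _, mul_one]
  calc (2 * Real.pi)⁻¹ * (δ n)⁻¹ * ‖unitExp (δ n) - 1 - 2 * Real.pi * Complex.I * δ n‖
      ≤ (2 * Real.pi)⁻¹ * (δ n)⁻¹ * ((2 * Real.pi) ^ 2 * (δ n) ^ 2) := by gcongr
    _ = 2 * Real.pi * δ n := by field_simp

/-- Fejér's theorem. -/
theorem tendsto_cesaroMean_unitExp_of_fwdDiff {g : ℕ → ℝ}
    (hlim : Tendsto (fwdDiff 1 g) atTop (𝓝 0))
    (hinf : Tendsto (fun n : ℕ => (n : ℝ) * |fwdDiff 1 g n|) atTop atTop)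
    (hs : HasEventualSign (fwdDiff 1 g)) (hss : HasEventualSign (fwdDiff 1 (fwdDiff 1 g))) :
    Tendsto (cesaroMean fun n => unitExp (g n)) atTop (𝓝 0) := by
  rcases hs with h | h | h
  · refine tendsto_cesaroMean_unitExp_of_pos hlim (hinf.congr' ?_) h
      (hss.succ_le_of_tendsto_zero hlim h)
    filter_upwards [h] with n hn
    rw [abs_of_pos hn]
  · exfalso
    obtain ⟨n, h1, h2⟩ := ((hinf.eventually_ge_atTop 1).and h).exists
    rw [h2] at h1
    norm_num at h1
  · have hneg : fwdDiff 1 (-g) = -fwdDiff 1 g := by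
      ext n
      simp [fwdDiff_one_apply]
      ring
    have hneg' : fwdDiff 1 (-fwdDiff 1 g) = -fwdDiff 1 (fwdDiff 1 g) := by
      ext n
      simp [fwdDiff_one_apply]
      ring
    have hlim' : Tendsto (fwdDiff 1 (-g)) atTop (𝓝 0) := by rw [hneg]; simpa using! hlim.neg
    have hpos : ∀ᶠ n in atTop, 0 < fwdDiff 1 (-g) n := by
      rw [hneg]; filter_upwards [h] with n hn; simpa using hn
    have h1 := tendsto_cesaroMean_unitExp_of_pos (g := -g) hlim' (hinf.congr' (by
      filter_upwards [h] with n hn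
      rw [abs_of_neg hn, hneg, Pi.neg_apply])) hpos
      (HasEventualSign.succ_le_of_tendsto_zero (by rw [hneg, hneg']; exact hss.neg) hlim' hpos)
    refine (tendsto_cesaroMean_conj h1).congr fun N => ?_
    simp only [conj_unitExp, Pi.neg_apply, neg_neg]

theorem iterate_fwdDiff_shift_sub (g : ℕ → ℝ) (h k n : ℕ) :
    (fwdDiff 1)^[k] (fun m => g (m + h) - g m) n
      = (fwdDiff 1)^[k] g (n + h) - (fwdDiff 1)^[k] g n := by
  induction k generalizing n with
  | zero => rfl
  | succ k ih =>
    simp only [Function.iterate_succ_apply', fwdDiff_one_apply, ih]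
    rw [show n + 1 + h = n + h + 1 by omega]
    ring

/-- The h increments from n to n + h eventually have the same sign, so none cancels the first. This
keeps differences large enough after a van der Corput step. -/
theorem abs_fwdDiff_le_abs_shift_sub {v : ℕ → ℝ} (hv : HasEventualSign (fwdDiff 1 v)) {h : ℕ}
    (hh : 1 ≤ h) : ∀ᶠ n in atTop, |fwdDiff 1 v n| ≤ |v (n + h) - v n| := by
  rcases hv.le_succ_or_succ_le with hm | hm
  · obtain ⟨N, hN⟩ := exists_monotone_add hm
    filter_upwards [eventually_ge_atTop N] with n hn
    have h1 := hN (show n - N ≤ n + 1 - N by omega)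
    have h2 := hN (show n + 1 - N ≤ n + h - N by omega)
    simp only [show n - N + N = n by omega, show n + 1 - N + N = n + 1 by omega,
      show n + h - N + N = n + h by omega] at h1 h2
    rw [fwdDiff_one_apply, abs_of_nonneg (by linarith), abs_of_nonneg (by linarith)]
    linarith
  · obtain ⟨N, hN⟩ := exists_monotone_add (s := fun n => -v n)
      (by filter_upwards [hm] with n hn; linarith)
    filter_upwards [eventually_ge_atTop N] with n hn
    have h1 := hN (show n - N ≤ n + 1 - N by omega)
    have h2 := hN (show n + 1 - N ≤ n + h - N by omega)
    simp only [show n - N + N = n by omega, show n + 1 - N + N = n + 1 by omega,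
      show n + h - N + N = n + h by omega] at h1 h2
    rw [fwdDiff_one_apply, abs_of_nonpos (by linarith), abs_of_nonpos (by linarith)]
    linarith

/-- Exponential sums along a sequence from a class of sequences of eventually constant sign, closed
under shifts and differences, whose differences of some order tend to zero more slowly than
`1 / n`. -/
theorem tendsto_cesaroMean_unitExp {C : Set (ℕ → ℝ)}
    (hsub : ∀ s ∈ C, ∀ t ∈ C, s - t ∈ C) (hshift : ∀ s ∈ C, (fun n => s (n + 1)) ∈ C)
    (hsign : ∀ s ∈ C, HasEventualSign s) (e : ℕ) : ∀ g ∈ C,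
    Tendsto ((fwdDiff 1)^[e + 1] g) atTop (𝓝 0) →
    Tendsto (fun n : ℕ => (n : ℝ) * |(fwdDiff 1)^[e + 1] g n|) atTop atTop →
    Tendsto (cesaroMean fun n => unitExp (g n)) atTop (𝓝 0) := by
  have hdiff : ∀ s ∈ C, fwdDiff 1 s ∈ C := fun s hs => hsub _ (hshift s hs) s hs
  have hiter : ∀ s ∈ C, ∀ k, (fwdDiff 1)^[k] s ∈ C := by
    intro s hs k
    induction k with
    | zero => exact hs
    | succ k ih => rw [Function.iterate_succ_apply']; exact hdiff _ ih
  have hshift' : ∀ s ∈ C, ∀ h, (fun n => s (n + h)) ∈ C := by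
    intro s hs h
    induction h with
    | zero => exact hs
    | succ h ih => simpa only [show ∀ n, n + 1 + h = n + (h + 1) by omega] using hshift _ ih
  induction e with
  | zero =>
    intro g hg h1 h2
    exact tendsto_cesaroMean_unitExp_of_fwdDiff h1 h2 (hsign _ (hdiff g hg))
      (hsign _ (hdiff _ (hdiff g hg)))
  | succ e ih =>
    intro g hg h1 h2
    -- The correlations are exponential sums along g(n+h) - g(n). Its difference of order e + 1 is a
    -- sum of h consecutive values of the difference of order e + 2 of g, so both hypotheses pass to
    -- it at one order less.
    refine tendsto_cesaroMean_of_correlations (fun n => norm_unitExp _) fun h hh => ?_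
    have h3 := ih (fun n => g (n + h) - g n) (hsub _ (hshift' g hg h) g hg) ?_ ?_
    · refine h3.congr fun N => ?_
      simp only [conj_unitExp, ← unitExp_add, sub_eq_add_neg]
    · have h4 : Tendsto (fun n => ∑ i ∈ Finset.range h, (fwdDiff 1)^[e + 1 + 1] g (n + i)) atTop
          (𝓝 0) := by
        simpa using tendsto_finsetSum (Finset.range h) fun i _ =>
          (tendsto_add_atTop_iff_nat i).2 h1
      refine h4.congr fun n => ?_
      have h5 := Finset.sum_range_sub (fun i => (fwdDiff 1)^[e + 1] g (n + i)) h
      simp only [add_zero] at h5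
      rw [iterate_fwdDiff_shift_sub, ← h5]
      refine Finset.sum_congr rfl fun i _ => ?_
      rw [Function.iterate_succ_apply', fwdDiff_one_apply]
      rfl
    · refine tendsto_atTop_mono' _ ?_ h2
      have h5 := abs_fwdDiff_le_abs_shift_sub (v := (fwdDiff 1)^[e + 1] g)
        (hsign _ (hdiff _ (hiter g hg _))) hh
      filter_upwards [h5] with n hn
      rw [iterate_fwdDiff_shift_sub, Function.iterate_succ_apply']
      gcongr

/-! ### Exponential sums over differences of a Hardy sequence -/

/-- Slow variation gives u(n+1) = O(u(n)), so a shifted sequence that is negligible at n + 1 is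
negligible against u(n) as well. -/
theorem isLittleO_iterate_fwdDiff {u : ℕ → ℝ} (hu : fwdDiff 1 u =o[atTop] u) (j : ℕ) :
    (fwdDiff 1)^[j + 1] u =o[atTop] u := by
  induction j with
  | zero => exact hu
  | succ j ih =>
    have h1 : (fun n => u (n + 1)) =O[atTop] u := by
      refine ((isBigO_refl u atTop).add hu.isBigO).congr_left fun n => ?_
      rw [fwdDiff_one_apply]
      ring
    have h2 : (fun n => (fwdDiff 1)^[j + 1] u (n + 1)) =o[atTop] u :=
      (ih.comp_tendsto (tendsto_add_atTop_nat 1)).trans_isBigO h1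
    rw [Function.iterate_succ_apply']
    exact (h2.sub ih)

theorem iterate_fwdDiff_sum_mul {ι : Type*} (A : Finset ι) (c : ι → ℝ) (f : ι → ℕ → ℝ) (k : ℕ) :
    (fwdDiff 1)^[k] (fun n => ∑ i ∈ A, c i * f i n)
      = fun n => ∑ i ∈ A, c i * (fwdDiff 1)^[k] (f i) n := by
  induction k with
  | zero => rfl
  | succ k ih =>
    ext n
    simp only [Function.iterate_succ_apply', ih, fwdDiff_one_apply, mul_sub,
      Finset.sum_sub_distrib]

namespace IsSequenceField

variable {F : Set (ℕ → ℝ)} (hF : IsSequenceField F)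
include hF

theorem sum_mem {ι : Type*} (A : Finset ι) {f : ι → ℕ → ℝ} (hf : ∀ i, f i ∈ F) :
    (fun n => ∑ i ∈ A, f i n) ∈ F := by
  classical
  induction A using Finset.induction_on with
  | empty =>
    simpa using hF.natCast_mem 0
  | insert a A ha ih =>
    simp only [Finset.sum_insert ha]
    exact hF.add_mem _ (hf a) _ ih

theorem intCast_mem (k : ℤ) : (fun _ => (k : ℝ)) ∈ F := by
  obtain ⟨n, rfl | rfl⟩ := k.eq_nat_or_neg
  · simpa using hF.natCast_mem n
  · have h := hF.neg_mem _ (hF.natCast_mem n)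
    simpa using! h

/-- Exponential sums over nontrivial combinations of the differences of a sequence of growth
strictly between `n ^ d log n` and `n ^ (d + 1)` and of its multiple by an irrational number. -/
theorem tendsto_cesaroMean_unitExp_differences {s : ℕ → ℝ} (hs : s ∈ F) (d : ℕ)
    (hlow : (fun n : ℕ => (n : ℝ) ^ d * Real.log n) =o[atTop] s)
    (hup : s =o[atTop] fun n : ℕ => (n : ℝ) ^ (d + 1)) {α : ℝ} (hα : Irrational α)
    (k l : Fin (d + 1) → ℤ) (hkl : ¬ (k = 0 ∧ l = 0)) :
    Tendsto (cesaroMean fun n => unitExp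
      (∑ i, ((k i : ℝ) + α * l i) * (fwdDiff 1)^[d - i] s n)) atTop (𝓝 0) := by
  obtain ⟨hu0, huinf, hslow⟩ := hF.slow_iterate_fwdDiff hs d hlow hup
  set u := (fwdDiff 1)^[d + 1] s with hu
  set c : Fin (d + 1) → ℝ := fun i => (k i : ℝ) + α * l i with hc
  have hc0 : ∀ i, c i = 0 → k i = 0 ∧ l i = 0 := by
    intro i hi
    by_cases hl : l i = 0
    · simp only [hc, hl, Int.cast_zero, mul_zero, add_zero, Int.cast_eq_zero] at hi
      exact ⟨hi, hl⟩
    · exfalso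
      have hl' : (l i : ℝ) ≠ 0 := by exact_mod_cast hl
      refine hα ⟨-(k i : ℚ) / l i, ?_⟩
      push_cast
      rw [div_eq_iff hl']
      simp only [hc] at hi
      linarith
  -- The largest index with a nonzero coefficient carries the difference of lowest order, d - e,
  -- which dominates: after e + 1 further differences it becomes u, and the other terms become
  -- higher differences of u.
  obtain ⟨e, he, hmax⟩ : ∃ e, c e ≠ 0 ∧ ∀ i, e < i → c i = 0 := by
    have hne : (Finset.univ.filter fun i => c i ≠ 0).Nonempty := by
      by_contra h
      rw [Finset.not_nonempty_iff_eq_empty, Finset.filter_eq_empty_iff] at h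
      refine hkl ⟨?_, ?_⟩ <;> ext i <;> have := hc0 i (not_not.1 (h (Finset.mem_univ i)))
      · exact this.1
      · exact this.2
    obtain ⟨e, he, hmax⟩ := Finset.exists_max_image _ id hne
    refine ⟨e, by simpa using he, fun i hi => ?_⟩
    by_contra h
    exact absurd (hmax i (by simpa using h)) (not_le.2 hi)
  set g : ℕ → ℝ := fun n => ∑ i, c i * (fwdDiff 1)^[d - i] s n with hg
  have hlead : (fun n => (fwdDiff 1)^[(e : ℕ) + 1] g n - c e * u n) =o[atTop] u := by
    have h1 : ∀ n, (fwdDiff 1)^[(e : ℕ) + 1] g n - c e * u n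
        = ∑ i ∈ Finset.univ.erase e, c i * (fwdDiff 1)^[(e : ℕ) + 1] ((fwdDiff 1)^[d - i] s) n := by
      intro n
      rw [hg, iterate_fwdDiff_sum_mul]
      beta_reduce
      rw [← Finset.add_sum_erase _ _ (Finset.mem_univ e),
        ← Function.iterate_add_apply, show (e : ℕ) + 1 + (d - e) = d + 1 by omega, ← hu]
      ring
    simp only [h1]
    refine IsLittleO.fun_sum fun i hi => ?_
    rcases lt_or_gt_of_ne (Finset.ne_of_mem_erase hi) with hie | hie
    · refine IsLittleO.const_mul_left ?_ _
      have hie' : (i : ℕ) < e := hie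
      rw [← Function.iterate_add_apply,
        show (e : ℕ) + 1 + (d - i) = ((e : ℕ) - i - 1 + 1) + (d + 1) by omega,
        Function.iterate_add_apply]
      exact isLittleO_iterate_fwdDiff hslow _
    · simp only [hmax i hie, zero_mul]
      exact isLittleO_zero _ _
  -- As α need not lie in the field, one works in F + αF, which still has subtraction, shifts and
  -- eventual signs.
  set C : Set (ℕ → ℝ) := {f | ∃ p ∈ F, ∃ q ∈ F, f = fun n => p n + α * q n} with hC
  refine tendsto_cesaroMean_unitExp (C := C) ?_ ?_ ?_ (e : ℕ) g ?_ ?_ ?_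
  · rintro _ ⟨p, hp, q, hq, rfl⟩ _ ⟨p', hp', q', hq', rfl⟩
    refine ⟨_, hF.sub_mem hp hp', _, hF.sub_mem hq hq', ?_⟩
    ext n
    simp only [Pi.sub_apply]
    ring
  · rintro _ ⟨p, hp, q, hq, rfl⟩
    exact ⟨_, hF.shift_mem p hp, _, hF.shift_mem q hq, rfl⟩
  · rintro _ ⟨p, hp, q, hq, rfl⟩
    exact hF.sign_add_mul hp hq α
  · refine ⟨_, hF.sum_mem Finset.univ fun i : Fin (d + 1) => hF.mul_mem _ (hF.intCast_mem (k i)) _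
      (hF.iterate_fwdDiff_mem hs (d - i)), _, hF.sum_mem Finset.univ fun i : Fin (d + 1) =>
      hF.mul_mem _ (hF.intCast_mem (l i)) _ (hF.iterate_fwdDiff_mem hs (d - i)), ?_⟩
    ext n
    simp only [hg, hc, Pi.mul_apply, Finset.mul_sum, ← Finset.sum_add_distrib]
    refine Finset.sum_congr rfl fun i _ => ?_
    ring
  · have h1 : (fwdDiff 1)^[(e : ℕ) + 1] g =O[atTop] u := by
      refine (hlead.isBigO.add ((isBigO_refl u atTop).const_mul_left (c e))).congr_left fun n => ?_
      ring
    exact h1.trans_tendsto hu0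
  · have hce : 0 < |c e| / 2 := by positivity
    refine tendsto_atTop_mono' _ ?_ (huinf.const_mul_atTop hce)
    filter_upwards [hlead.bound hce] with n hn
    rw [Real.norm_eq_abs, Real.norm_eq_abs] at hn
    have h1 : |c e| * |u n| ≤ |(fwdDiff 1)^[(e : ℕ) + 1] g n| + |c e| / 2 * |u n| := by
      rw [← abs_mul]
      calc |c e * u n| = |(fwdDiff 1)^[(e : ℕ) + 1] g n
            - ((fwdDiff 1)^[(e : ℕ) + 1] g n - c e * u n)| := by rw [sub_sub_cancel]
        _ ≤ _ := (abs_sub _ _).trans (by gcongr)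
    calc |c e| / 2 * ((n : ℝ) * |u n|) = n * (|c e| / 2 * |u n|) := by ring
      _ ≤ n * |(fwdDiff 1)^[(e : ℕ) + 1] g n| := by
        gcongr
        linarith

end IsSequenceField

/-! ### Weyl's criterion on tori -/

/-- The sequence `x` is equidistributed with respect to the measure `ν`. -/
def IsEquidistributed {X : Type*} [TopologicalSpace X] [MeasurableSpace X] (x : ℕ → X)
    (ν : Measure X) : Prop :=
  ∀ f : C(X, ℂ), Tendsto (cesaroMean fun n => f (x n)) atTop (𝓝 (∫ y, f y ∂ν))

instance isProbabilityMeasure_volume_unitAddCircle :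
    IsProbabilityMeasure (volume : Measure UnitAddCircle) :=
  ⟨by simp⟩

theorem integral_fourier_unitAddCircle {n : ℤ} (hn : n ≠ 0) :
    ∫ x : UnitAddCircle, fourier n x = 0 :=
  integral_eq_zero_of_add_right_eq_neg (fourier_add_half_inv_index hn one_pos)

theorem integral_mFourier {ι : Type*} [Fintype ι] {n : ι → ℤ} (hn : n ≠ 0) :
    ∫ x : UnitAddTorus ι, UnitAddTorus.mFourier n x = 0 := by
  obtain ⟨i, hi⟩ := Function.ne_iff.1 hn
  change ∫ x : ι → UnitAddCircle, ∏ i, fourier (n i) (x i) = 0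
  rw [MeasureTheory.integral_fintype_prod_volume_eq_prod]
  exact Finset.prod_eq_zero (Finset.mem_univ i) (integral_fourier_unitAddCircle hi)

theorem continuousMap_integrable {X : Type*} [TopologicalSpace X] [CompactSpace X]
    [MeasurableSpace X] [BorelSpace X] (ν : Measure X) [IsFiniteMeasure ν] (f : C(X, ℂ)) :
    Integrable f ν :=
  (BoundedContinuousFunction.mkOfCompact f).integrable ν

/-- Equidistribution may be tested on functions that span a dense subspace. -/
theorem isEquidistributed_of_span {X : Type*} [TopologicalSpace X] [CompactSpace X]
    [MeasurableSpace X] [BorelSpace X] {x : ℕ → X} {ν : Measure X} [IsProbabilityMeasure ν]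
    {A : Set C(X, ℂ)} (hA : (Submodule.span ℂ A).topologicalClosure = ⊤)
    (h : ∀ f ∈ A, Tendsto (cesaroMean fun n => f (x n)) atTop (𝓝 (∫ y, f y ∂ν))) :
    IsEquidistributed x ν := by
  have hspan : ∀ f ∈ Submodule.span ℂ A,
      Tendsto (cesaroMean fun n => f (x n)) atTop (𝓝 (∫ y, f y ∂ν)) := by
    intro f hf
    induction hf using Submodule.span_induction with
    | mem f hf => exact h f hf
    | zero =>
      rw [show ∫ y, (0 : C(X, ℂ)) y ∂ν = 0 by simp]
      exact tendsto_const_nhds.congr fun N => by simp [cesaroMean]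
    | add f g _ _ hf hg =>
      simp only [ContinuousMap.add_apply]
      rw [integral_add (continuousMap_integrable ν f) (continuousMap_integrable ν g)]
      refine (hf.add hg).congr fun N => ?_
      simp [cesaroMean, Finset.sum_add_distrib, mul_add]
    | smul c f _ hf =>
      simp only [ContinuousMap.smul_apply, smul_eq_mul]
      rw [integral_const_mul]
      exact (hf.const_mul c).congr fun N => (cesaroMean_const_mul _ _ _).symm
  intro f
  have hf : f ∈ closure (Submodule.span ℂ A : Set C(X, ℂ)) := by
    rw [← Submodule.topologicalClosure_coe, hA]
    trivial
  rw [Metric.tendsto_nhds]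
  intro ε hε
  obtain ⟨p, hp, hfp⟩ := Metric.mem_closure_iff.1 hf (ε / 3) (by positivity)
  rw [dist_eq_norm] at hfp
  filter_upwards [Metric.tendsto_nhds.1 (hspan p hp) (ε / 3) (by positivity)] with N hN
  have h1 : ‖cesaroMean (fun n => f (x n)) N - cesaroMean (fun n => p (x n)) N‖ ≤ ‖f - p‖ := by
    rw [← cesaroMean_sub]
    exact norm_cesaroMean_le (norm_nonneg _) (fun n => (f - p).norm_coe_le_norm _) N
  have h2 : ‖∫ y, f y ∂ν - ∫ y, p y ∂ν‖ ≤ ‖f - p‖ := by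
    rw [← integral_sub (continuousMap_integrable ν f) (continuousMap_integrable ν p)]
    simpa using norm_integral_le_of_norm_le_const (μ := ν)
      (Eventually.of_forall fun y => (f - p).norm_coe_le_norm y)
  rw [dist_eq_norm] at hN ⊢
  calc _ = ‖(cesaroMean (fun n => f (x n)) N - cesaroMean (fun n => p (x n)) N)
        + (cesaroMean (fun n => p (x n)) N - ∫ y, p y ∂ν)
        - (∫ y, f y ∂ν - ∫ y, p y ∂ν)‖ := by congr 1; ring
    _ ≤ _ := (norm_sub_le _ _).trans (add_le_add_left (norm_add_le _ _) _)
    _ < ε := by linarith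

theorem isEquidistributed_unitAddTorus {ι : Type*} [Fintype ι] {x : ℕ → UnitAddTorus ι}
    (h : ∀ n : ι → ℤ, n ≠ 0 →
      Tendsto (cesaroMean fun m => UnitAddTorus.mFourier n (x m)) atTop (𝓝 0)) :
    IsEquidistributed x volume := by
  refine isEquidistributed_of_span UnitAddTorus.span_mFourier_closure_eq_top ?_
  rintro _ ⟨n, rfl⟩
  by_cases hn : n = 0
  · subst hn
    simp only [UnitAddTorus.mFourier_zero, ContinuousMap.one_apply]
    refine tendsto_cesaroMean ?_
    simp
  · rw [integral_mFourier hn]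
    exact h n hn

theorem IsEquidistributed.map {X Y : Type*} [TopologicalSpace X] [TopologicalSpace Y]
    [MeasurableSpace X] [MeasurableSpace Y] [OpensMeasurableSpace Y] {x : ℕ → X} {ν : Measure X}
    {ν' : Measure Y} (hx : IsEquidistributed x ν) {p : X → Y} (hp : Continuous p)
    (hν : MeasurePreserving p ν ν') : IsEquidistributed (fun n => p (x n)) ν' := by
  intro f
  have := hx (f.comp ⟨p, hp⟩)
  rw [← hν.map_eq, integral_map hν.measurable.aemeasurable
    (f.continuous.measurable.aestronglyMeasurable)]
  exact this

/-- Weyl's criterion on a product of two tori. -/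
theorem isEquidistributed_prod {ι κ : Type*} [Fintype ι] [Fintype κ]
    {x : ℕ → (ι → UnitAddCircle) × (κ → UnitAddCircle)}
    (h : ∀ (k : ι → ℤ) (l : κ → ℤ), ¬ (k = 0 ∧ l = 0) → Tendsto (cesaroMean fun m =>
      (∏ i, fourier (k i) ((x m).1 i)) * ∏ i, fourier (l i) ((x m).2 i)) atTop (𝓝 0)) :
    IsEquidistributed x volume := by
  have h1 : IsEquidistributed (fun m => (Sum.elim (x m).1 (x m).2 : UnitAddTorus (ι ⊕ κ)))
      volume := by
    refine isEquidistributed_unitAddTorus fun n hn => ?_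
    refine (h (fun i => n (Sum.inl i)) (fun j => n (Sum.inr j)) ?_).congr fun N => ?_
    · rintro ⟨h1, h2⟩
      refine hn (funext fun i => ?_)
      rcases i with i | i
      · exact congrFun h1 i
      · exact congrFun h2 i
    · simp [UnitAddTorus.mFourier, Fintype.prod_sum_type]
  exact h1.map (p := fun y => (fun i => y (Sum.inl i), fun j => y (Sum.inr j))) (by fun_prop)
    (volume_measurePreserving_sumPiEquivProdPi fun _ : ι ⊕ κ => UnitAddCircle)

/-! ### Asymptotic pseudo-orbits -/

theorem Homeomorph.zpow_add_one_apply {X : Type*} [TopologicalSpace X] (S : X ≃ₜ X) (n : ℤ)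
    (x : X) : (S ^ (n + 1)) x = (S ^ n) (S x) := by
  rw [zpow_add_one]
  rfl

theorem Homeomorph.zpow_one_add_apply {X : Type*} [TopologicalSpace X] (S : X ≃ₜ X) (n : ℤ)
    (x : X) : (S ^ (n + 1)) x = S ((S ^ n) x) := by
  rw [add_comm, zpow_one_add]
  rfl

/-- For each fixed n only |n| small errors accumulate, and uniform continuity of S and of its
inverse on a compact space keeps them small. -/
theorem tendsto_uniformity_zpow {X : Type*} [UniformSpace X] [CompactSpace X] (S : X ≃ₜ X)
    {w : ℤ → X} (h : Tendsto (fun m : ℤ => (w (m + 1), S (w m))) atTop (𝓤 X)) (n : ℤ) :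
    Tendsto (fun m : ℤ => (w (m + n), (S ^ n) (w m))) atTop (𝓤 X) := by
  have hS := CompactSpace.uniformContinuous_of_continuous S.continuous
  have hS' := CompactSpace.uniformContinuous_of_continuous S.symm.continuous
  have hshift : ∀ k : ℤ, Tendsto (fun m : ℤ => m + k) atTop atTop := fun k =>
    tendsto_atTop_add_const_right _ k tendsto_id
  induction n using Int.induction_on with
  | zero => simpa using tendsto_diag_uniformity w atTop
  | succ n ih =>
    have h1 : Tendsto (fun m : ℤ => (w (m + (n + 1)), S (w (m + n)))) atTop (𝓤 X) := by
      simpa only [Function.comp_def, add_assoc] using h.comp (hshift n)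
    have h2 := Tendsto.comp hS ih
    refine (h1.uniformity_trans h2).congr fun m => ?_
    rw [Homeomorph.zpow_one_add_apply]
  | pred n ih =>
    have h1 := Tendsto.comp hS' (h.comp (hshift (-n - 1)))
    have h2 := Tendsto.comp hS' ih
    have h3 : Tendsto (fun m : ℤ => (w (m + (-n - 1)), S.symm (w (m + -n)))) atTop (𝓤 X) := by
      refine h1.uniformity_symm.congr fun m => ?_
      simp [add_assoc]
    refine (h3.uniformity_trans h2).congr fun m => ?_
    have h4 := Homeomorph.zpow_one_add_apply S (-n - 1) (w m)
    rw [sub_add_cancel] at h4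
    simp only [h4, Homeomorph.symm_apply_apply]

theorem tendsto_sub_of_tendsto_uniformity {Y : Type*} [UniformSpace Y] [CompactSpace Y]
    (f : C(Y, ℂ)) {x y : ℕ → Y} (h : Tendsto (fun m => (x m, y m)) atTop (𝓤 Y)) :
    Tendsto ((fun m => f (x m)) - fun m => f (y m)) atTop (𝓝 0) := by
  have h1 := Tendsto.comp (CompactSpace.uniformContinuous_of_continuous f.continuous) h
  rw [tendsto_zero_iff_norm_tendsto_zero]
  have h2 := tendsto_uniformity_iff_dist_tendsto_zero.1 h1
  simpa only [dist_eq_norm] using! h2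

theorem tendsto_pi_uniformity {ι Z A : Type*} [UniformSpace Z] {l : Filter A} {x y : A → ι → Z}
    (h : ∀ i, Tendsto (fun a => (x a i, y a i)) l (𝓤 Z)) :
    Tendsto (fun a => (x a, y a)) l (𝓤 (ι → Z)) := by
  rw [Pi.uniformity, tendsto_iInf]
  exact fun i => tendsto_comap_iff.2 (h i)

/-! ### Orbit limits and itineraries -/

theorem iterate_shift_apply {Z : Type*} (z : ℤ → Z) (m : ℕ) (n : ℤ) :
    (shift Z)^[m] z n = z (n + m) := by
  induction m generalizing n with
  | zero => simp
  | succ m ih =>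
    rw [Function.iterate_succ_apply', shift, ih]
    push_cast
    ring_nf

theorem inv_mul_sum_Icc_eq_cesaroMean (F : ℕ → ℂ) (M : ℕ) :
    (M : ℂ)⁻¹ * ∑ m ∈ Finset.Icc 1 M, F m = cesaroMean (fun n => F (n + 1)) M := by
  rw [cesaroMean, Finset.range_eq_Ico, Finset.sum_Ico_add' F 0 M 1]
  rfl

theorem isOrbitLimit_of_tendsto_cesaroMean {Z : Type*} [MetricSpace Z] [CompactSpace Z]
    [MeasurableSpace Z] {z : ℤ → Z} {μ : Measure (ℤ → Z)} [hμ : IsProbabilityMeasure μ]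
    (h : ∀ f : C(ℤ → Z, ℂ),
      Tendsto (cesaroMean fun m => f ((shift Z)^[m] z)) atTop (𝓝 (∫ x, f x ∂μ))) :
    IsOrbitLimit z μ := by
  refine ⟨hμ, fun f => ?_⟩
  have h1 := tendsto_cesaroMean_shift (fun m => f.norm_coe_le_norm ((shift Z)^[m] z)) (h f) 1
  exact h1.congr fun M =>
    (inv_mul_sum_Icc_eq_cesaroMean (fun m => f ((shift Z)^[m] z)) M).symm

/-- The bi-infinite itinerary of a point under `S`, as seen through `q`. -/
def itinerary {X Z : Type*} [TopologicalSpace X] (S : X ≃ₜ X) (q : X → Z) (x : X) : ℤ → Z :=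
  fun n => q ((S ^ n) x)

theorem itinerary_apply_map {X Z : Type*} [TopologicalSpace X] (S : X ≃ₜ X) (q : X → Z) (x : X) :
    itinerary S q (S x) = shift Z (itinerary S q x) := by
  ext n
  simp only [itinerary, shift, Homeomorph.zpow_add_one_apply]

theorem continuous_itinerary {X Z : Type*} [TopologicalSpace X] [TopologicalSpace Z] (S : X ≃ₜ X)
    {q : X → Z} (hq : Continuous q) : Continuous (itinerary S q) :=
  continuous_pi fun n => hq.comp (S ^ n).continuous

theorem measurable_itinerary {X Z : Type*} [TopologicalSpace X] [MeasurableSpace X] [BorelSpace X]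
    [MeasurableSpace Z] (S : X ≃ₜ X) {q : X → Z} (hq : Measurable q) :
    Measurable (itinerary S q) :=
  measurable_pi_lambda _ fun n => hq.comp (S ^ n).continuous.measurable

/-- At each fixed place n the m-th shift of the sequence reads q(w(m+n)), asymptotically q(S^n
w(m)). So the shifts are asymptotic to the itineraries of the points w(m), to which equidistribution
applies. -/
theorem hasUniqueFurstenbergSystem_of_pseudoOrbit {X Z : Type*} [UniformSpace X] [CompactSpace X]
    [MeasurableSpace X] [BorelSpace X] [MetricSpace Z] [CompactSpace Z] [MeasurableSpace Z]
    [BorelSpace Z] (S : X ≃ₜ X) {ν : Measure X} [IsProbabilityMeasure ν] {w : ℤ → X}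
    (hw : Tendsto (fun m : ℤ => (w (m + 1), S (w m))) atTop (𝓤 X))
    (hequi : IsEquidistributed (fun n : ℕ => w n) ν) {q : X → Z} (hq : Continuous q) {b : ℕ → Z}
    (hb : ∀ n : ℕ, 1 ≤ n → b n = q (w n)) :
    HasUniqueFurstenbergSystem b (ν.map (itinerary S q)) := by
  intro z hz
  have hcont := continuous_itinerary S hq
  have hmeas := measurable_itinerary S hq.measurable
  have := Measure.isProbabilityMeasure_map (μ := ν) hmeas.aemeasurable
  refine isOrbitLimit_of_tendsto_cesaroMean fun f => ?_
  have h1 := hequi (f.comp ⟨_, hcont⟩)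
  rw [integral_map hmeas.aemeasurable f.continuous.measurable.aestronglyMeasurable]
  refine tendsto_cesaroMean_of_sub h1 (tendsto_sub_of_tendsto_uniformity f ?_)
  refine tendsto_pi_uniformity fun n => ?_
  have h2 := Tendsto.comp (CompactSpace.uniformContinuous_of_continuous hq)
    ((tendsto_uniformity_zpow S hw n).comp tendsto_natCast_atTop_atTop)
  refine h2.congr' ?_
  -- This makes n + m ≥ 1, where the extension z agrees with b.
  filter_upwards [eventually_ge_atTop (1 - n).toNat] with m hm
  have h3 : n + m = ((n + m).toNat : ℤ) := by omega
  simp only [Function.comp_apply, ContinuousMap.coe_mk, itinerary]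
  rw [iterate_shift_apply, h3, hz _ (by omega), hb _ (by omega), ← h3, add_comm]

theorem isSystem_shift {Z : Type*} [MeasurableSpace Z] {μ : Measure (ℤ → Z)}
    [hμ : IsProbabilityMeasure μ] (h : MeasurePreserving (shift Z) μ μ) : IsSystem μ (shift Z) := by
  refine ⟨hμ, ⟨⟨⟨shift Z, fun x n => x (n - 1), fun x => ?_, fun x => ?_⟩, h.measurable, ?_⟩, rfl⟩, h⟩
  · ext n
    simp [shift]
  · ext n
    simp [shift]
  · exact measurable_pi_lambda _ fun n => measurable_pi_apply _

theorem isSystem_homeomorph {X : Type*} [TopologicalSpace X] [MeasurableSpace X] [BorelSpace X]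
    (S : X ≃ₜ X) {ν : Measure X} [hν : IsProbabilityMeasure ν] (hS : MeasurePreserving S ν ν) :
    IsSystem ν S :=
  ⟨hν, ⟨S.toMeasurableEquiv, rfl⟩, hS⟩

theorem measurePreserving_shift_itinerary {X Z : Type*} [TopologicalSpace X] [MeasurableSpace X]
    [BorelSpace X] [MeasurableSpace Z] (S : X ≃ₜ X) {ν : Measure X} (hS : MeasurePreserving S ν ν)
    {q : X → Z} (hq : Measurable q) :
    MeasurePreserving (shift Z) (ν.map (itinerary S q)) (ν.map (itinerary S q)) := by
  have hmeas := measurable_itinerary S hq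
  have hshift : Measurable (shift Z) := measurable_pi_lambda _ fun n => measurable_pi_apply _
  refine ⟨hshift, ?_⟩
  rw [Measure.map_map hshift hmeas]
  conv_rhs => rw [← hS.map_eq, Measure.map_map hmeas hS.measurable]
  congr 1
  ext1 x
  exact (itinerary_apply_map S q x).symm

theorem isFactorOf_itinerary {X Z : Type*} [TopologicalSpace X] [MeasurableSpace X]
    [BorelSpace X] [MeasurableSpace Z] (S : X ≃ₜ X) {ν : Measure X} [IsProbabilityMeasure ν]
    (hS : MeasurePreserving S ν ν) {q : X → Z} (hq : Measurable q) :
    IsFactorOf (ν.map (itinerary S q)) (shift Z) ν S := by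
  have hmeas := measurable_itinerary S hq
  have := Measure.isProbabilityMeasure_map (μ := ν) hmeas.aemeasurable
  exact ⟨isSystem_shift (measurePreserving_shift_itinerary S hS hq), isSystem_homeomorph S hS,
    itinerary S q, ⟨hmeas, rfl⟩, Eventually.of_forall fun x => itinerary_apply_map S q x⟩

/-- An injective continuous map on a compact space is a closed embedding here, so it has a
measurable inverse on its range, and the range carries the whole image measure. -/
theorem isIsomorphicTo_itinerary {X Z : Type*} [TopologicalSpace X] [CompactSpace X]
    [MeasurableSpace X] [BorelSpace X] [MetricSpace Z] [CompactSpace Z] [MeasurableSpace Z]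
    [BorelSpace Z] (S : X ≃ₜ X) {ν : Measure X} [IsProbabilityMeasure ν]
    (hS : MeasurePreserving S ν ν) {q : X → Z} (hq : Continuous q)
    (hinj : Function.Injective (itinerary S q)) :
    IsIsomorphicTo (ν.map (itinerary S q)) (shift Z) ν S := by
  have hmeas := measurable_itinerary S hq.measurable
  have := Measure.isProbabilityMeasure_map (μ := ν) hmeas.aemeasurable
  have : Nonempty X := nonempty_of_isProbabilityMeasure ν
  have hemb : MeasurableEmbedding (itinerary S q) :=
    ((continuous_itinerary S hq).isClosedEmbedding hinj).measurableEmbedding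
  have hleft : ∀ x, hemb.invFun (itinerary S q x) = x := hemb.leftInverse_invFun
  have hrange := ae_map_mem_range (itinerary S q) hemb.measurableSet_range ν
  refine ⟨isSystem_shift (measurePreserving_shift_itinerary S hS hq.measurable),
    isSystem_homeomorph S hS, itinerary S q, hemb.invFun, ⟨hmeas, rfl⟩,
    ⟨hemb.measurable_invFun, ?_⟩, Eventually.of_forall fun x => itinerary_apply_map S q x, ?_,
    Eventually.of_forall hleft, ?_⟩
  · rw [Measure.map_map hemb.measurable_invFun hmeas, show hemb.invFun ∘ itinerary S q = id from
      funext hleft, Measure.map_id]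
  · filter_upwards [hrange]
    rintro _ ⟨x, rfl⟩
    rw [← itinerary_apply_map, hleft, hleft]
  · filter_upwards [hrange]
    rintro _ ⟨x, rfl⟩
    rw [hleft]

/-! ### The unipotent system -/

theorem unipotent_zero (d : ℕ) (y : Fin (d + 1) → UnitAddCircle) : unipotent d y 0 = y 0 := rfl

theorem unipotent_succ (d : ℕ) (y : Fin (d + 1) → UnitAddCircle) (j : Fin d) :
    unipotent d y j.succ = y j.succ + y j.castSucc := rfl

theorem continuous_unipotent (d : ℕ) : Continuous (unipotent d) := by
  refine continuous_pi fun i => ?_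
  refine Fin.cases ?_ (fun j => ?_) i
  · simp only [unipotent_zero]
    fun_prop
  · simp only [unipotent_succ]
    fun_prop

theorem bijective_unipotent (d : ℕ) : Function.Bijective (unipotent d) := by
  constructor
  · intro x y h
    ext i
    induction i using Fin.induction with
    | zero => exact congrFun h 0
    | succ j ih =>
      have h1 := congrFun h j.succ
      rw [unipotent_succ, unipotent_succ, ih] at h1
      exact add_right_cancel h1
  · intro x
    refine ⟨fun i => Fin.induction (motive := fun _ => UnitAddCircle) (x 0)
      (fun j y => x j.succ - y) i, ?_⟩
    ext i
    refine Fin.cases ?_ (fun j => ?_) i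
    · rfl
    · rw [unipotent_succ, Fin.induction_succ, sub_add_cancel]

/-- The map `unipotent d` as a homeomorphism. -/
noncomputable def unipotentHomeomorph (d : ℕ) :
    (Fin (d + 1) → UnitAddCircle) ≃ₜ (Fin (d + 1) → UnitAddCircle) :=
  Continuous.homeoOfEquivCompactToT2 (f := Equiv.ofBijective _ (bijective_unipotent d))
    (continuous_unipotent d)

/-- A continuous surjective endomorphism of a compact group preserves its Haar probability measure.
-/
theorem measurePreserving_unipotent (d : ℕ) : MeasurePreserving (unipotent d) volume volume := by
  have h := AddMonoidHom.measurePreserving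
    (μ := (volume : Measure (Fin (d + 1) → UnitAddCircle)))
    (ν := (volume : Measure (Fin (d + 1) → UnitAddCircle)))
    (f := { toFun := unipotent d
            map_zero' := by
              ext i
              refine Fin.cases ?_ (fun j => ?_) i
              · rfl
              · simp [unipotent_succ]
            map_add' := fun x y => by
              ext i
              refine Fin.cases ?_ (fun j => ?_) i
              · rfl
              · simp only [unipotent_succ, Pi.add_apply]
                abel })
    (continuous_unipotent d) (bijective_unipotent d).2 rfl
  exact h

/-- The square `S_d × S_d` of the unipotent map as a homeomorphism. -/
noncomputable def unipotentSquare (d : ℕ) :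
    ((Fin (d + 1) → UnitAddCircle) × (Fin (d + 1) → UnitAddCircle)) ≃ₜ
      ((Fin (d + 1) → UnitAddCircle) × (Fin (d + 1) → UnitAddCircle)) :=
  (unipotentHomeomorph d).prodCongr (unipotentHomeomorph d)

theorem coe_unipotentSquare (d : ℕ) :
    ⇑(unipotentSquare d) = Prod.map (unipotent d) (unipotent d) := rfl

theorem measurePreserving_unipotentSquare (d : ℕ) :
    MeasurePreserving (unipotentSquare d) volume volume :=
  (measurePreserving_unipotent d).prod (measurePreserving_unipotent d)

/-- The pair of last coordinates of a point of `𝕋 ^ (d + 1) × 𝕋 ^ (d + 1)`. -/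
def lastPair (d : ℕ) (x : (Fin (d + 1) → UnitAddCircle) × (Fin (d + 1) → UnitAddCircle)) :
    UnitAddCircle × UnitAddCircle :=
  (x.1 (Fin.last d), x.2 (Fin.last d))

theorem continuous_lastPair (d : ℕ) : Continuous (lastPair d) := by
  unfold lastPair
  fun_prop

theorem measurePreserving_lastPair (d : ℕ) : MeasurePreserving (lastPair d) volume volume :=
  (measurePreserving_eval (fun _ : Fin (d + 1) => (volume : Measure UnitAddCircle))
    (Fin.last d)).prod
    (measurePreserving_eval (fun _ : Fin (d + 1) => (volume : Measure UnitAddCircle)) (Fin.last d))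

/-- Coordinate i at time n is coordinate i + 1 at time n + 1 minus coordinate i + 1 at time n.
Knowing the last coordinates at all times thus determines the others by downward induction. -/
theorem injective_itinerary_lastPair (d : ℕ) :
    Function.Injective (itinerary (unipotentSquare d) (lastPair d)) := by
  intro x y h
  set S := unipotentSquare d with hS
  have h1 : ∀ i : Fin (d + 1), ∀ n : ℤ,
      ((S ^ n) x).1 i = ((S ^ n) y).1 i ∧ ((S ^ n) x).2 i = ((S ^ n) y).2 i := by
    intro i
    induction i using Fin.reverseInduction with
    | last => exact fun n => Prod.ext_iff.1 (congrFun h n)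
    | cast i ih =>
      intro n
      have h2 := ih n
      have h3 := ih (n + 1)
      simp only [Homeomorph.zpow_one_add_apply] at h3
      simp only [hS, coe_unipotentSquare, Prod.map_fst, Prod.map_snd, unipotent_succ] at h2 h3
      rw [h2.1, h2.2] at h3
      exact ⟨add_left_cancel h3.1, add_left_cancel h3.2⟩
  refine Prod.ext (funext fun i => ?_) (funext fun i => ?_)
  · simpa using! (h1 i 0).1
  · simpa using! (h1 i 0).2

/-! ### The pseudo-orbit of differences -/

theorem tendsto_uniformity_coe {A : Type*} {l : Filter A} {x y : A → ℝ}
    (h : Tendsto (fun a => x a - y a) l (𝓝 0)) :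
    Tendsto (fun a => ((x a : UnitAddCircle), (y a : UnitAddCircle))) l (𝓤 UnitAddCircle) := by
  have h1 : UniformContinuous (QuotientAddGroup.mk' (AddSubgroup.zmultiples (1 : ℝ))) :=
    uniformContinuous_addMonoidHom_of_continuous (AddCircle.continuous_mk' 1)
  refine Tendsto.comp h1 (?_ : Tendsto (fun a => (x a, y a)) l (𝓤 ℝ))
  rw [tendsto_uniformity_iff_dist_tendsto_zero]
  simpa only [dist_eq_norm] using tendsto_zero_iff_norm_tendsto_zero.1 h

theorem tendsto_prod_uniformity {X Y A : Type*} [UniformSpace X] [UniformSpace Y] {l : Filter A}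
    {x y : A → X × Y} (h₁ : Tendsto (fun a => ((x a).1, (y a).1)) l (𝓤 X))
    (h₂ : Tendsto (fun a => ((x a).2, (y a).2)) l (𝓤 Y)) :
    Tendsto (fun a => (x a, y a)) l (𝓤 (X × Y)) := by
  rw [uniformity_prod, tendsto_inf]
  exact ⟨tendsto_comap_iff.2 h₁, tendsto_comap_iff.2 h₂⟩

/-- The multiples by `c` of the differences of orders `d, …, 0` of a sequence, modulo one. -/
noncomputable def differenceOrbit (s : ℕ → ℝ) (d : ℕ) (c : ℝ) (m : ℤ) :
    Fin (d + 1) → UnitAddCircle :=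
  fun i => ((c * (fwdDiff 1)^[d - i] s m.toNat : ℝ) : UnitAddCircle)

/-- For m ≥ 0 every coordinate but the one of index 0 follows the map exactly; that one misses by c
times the difference of order d + 1. -/
theorem tendsto_uniformity_differenceOrbit {s : ℕ → ℝ} {d : ℕ}
    (h : Tendsto ((fwdDiff 1)^[d + 1] s) atTop (𝓝 0)) (c : ℝ) :
    Tendsto (fun m : ℤ => (differenceOrbit s d c (m + 1), unipotent d (differenceOrbit s d c m)))
      atTop (𝓤 (Fin (d + 1) → UnitAddCircle)) := by
  have htoNat : Tendsto Int.toNat atTop atTop :=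
    tendsto_atTop.2 fun b => by
      filter_upwards [eventually_ge_atTop (b : ℤ)] with m hm
      omega
  have hsucc : ∀ᶠ m : ℤ in atTop, (m + 1).toNat = m.toNat + 1 := by
    filter_upwards [eventually_ge_atTop 0] with m hm
    omega
  refine tendsto_pi_uniformity fun i => ?_
  refine Fin.cases ?_ (fun j => ?_) i
  · simp only [unipotent_zero, differenceOrbit]
    refine tendsto_uniformity_coe ?_
    have h1 := (h.comp htoNat).const_mul c
    rw [mul_zero] at h1
    refine h1.congr' ?_
    filter_upwards [hsucc] with m hm
    rw [hm, Function.comp_apply, Function.iterate_succ_apply', fwdDiff_one_apply]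
    simp only [Fin.val_zero, Nat.sub_zero]
    ring
  · simp only [unipotent_succ, differenceOrbit, ← AddCircle.coe_add]
    refine tendsto_uniformity_coe ?_
    refine tendsto_const_nhds.congr' ?_
    filter_upwards [hsucc] with m hm
    have h1 : d - (j.castSucc : ℕ) = (d - (j.succ : ℕ)) + 1 := by
      have := j.2
      simp only [Fin.val_castSucc, Fin.val_succ]
      omega
    rw [hm, h1, Function.iterate_succ_apply', fwdDiff_one_apply]
    ring

theorem fourier_coe_eq_unitExp (k : ℤ) (t : ℝ) :
    fourier k (t : UnitAddCircle) = unitExp (k * t) := by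
  rw [fourier_coe_apply, unitExp]
  congr 1
  push_cast
  ring

theorem unitExp_sum {ι : Type*} (A : Finset ι) (f : ι → ℝ) :
    unitExp (∑ i ∈ A, f i) = ∏ i ∈ A, unitExp (f i) := by
  simp only [unitExp, ← Complex.exp_sum, ← Finset.mul_sum, Complex.ofReal_sum]

namespace IsSequenceField

variable {F : Set (ℕ → ℝ)} (hF : IsSequenceField F)
include hF

theorem isEquidistributed_differenceOrbit {s : ℕ → ℝ} (hs : s ∈ F) (d : ℕ)
    (hlow : (fun n : ℕ => (n : ℝ) ^ d * Real.log n) =o[atTop] s)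
    (hup : s =o[atTop] fun n : ℕ => (n : ℝ) ^ (d + 1)) {α : ℝ} (hα : Irrational α) :
    IsEquidistributed (fun n : ℕ => (differenceOrbit s d 1 n, differenceOrbit s d α n)) volume := by
  refine isEquidistributed_prod fun k l hkl => ?_
  refine (hF.tendsto_cesaroMean_unitExp_differences hs d hlow hup hα k l hkl).congr fun N => ?_
  congr 1
  ext n
  simp only [differenceOrbit, fourier_coe_eq_unitExp, ← unitExp_sum, ← unitExp_add,
    Int.toNat_natCast, ← Finset.sum_add_distrib]
  congr 1
  refine Finset.sum_congr rfl fun i _ => ?_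
  ring

/-- The joint Furstenberg system of `s` and `α s` modulo one. -/
theorem hasUniqueFurstenbergSystem_pair {s : ℕ → ℝ} (hs : s ∈ F) (d : ℕ)
    (hlow : (fun n : ℕ => (n : ℝ) ^ d * Real.log n) =o[atTop] s)
    (hup : s =o[atTop] fun n : ℕ => (n : ℝ) ^ (d + 1)) {α : ℝ} (hα : Irrational α) :
    HasUniqueFurstenbergSystem
      (fun n : ℕ => ((s n : UnitAddCircle), ((α * s n : ℝ) : UnitAddCircle)))
      (volume.map (itinerary (unipotentSquare d) (lastPair d))) := by
  have h := (hF.slow_iterate_fwdDiff hs d hlow hup).1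
  refine hasUniqueFurstenbergSystem_of_pseudoOrbit (unipotentSquare d)
    (w := fun m => (differenceOrbit s d 1 m, differenceOrbit s d α m))
    (tendsto_prod_uniformity (tendsto_uniformity_differenceOrbit h 1)
      (tendsto_uniformity_differenceOrbit h α))
    (hF.isEquidistributed_differenceOrbit hs d hlow hup hα) (continuous_lastPair d) fun n _ => ?_
  simp [lastPair, differenceOrbit]

end IsSequenceField

/-! ### Weak convergence under almost everywhere continuous maps -/

/-- Portmanteau argument: at a point of continuity, lying in the preimage of an open set means lying
in its interior, so the limit measure loses nothing by passing to the interior. -/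
theorem tendsto_map_of_ae_continuousAt {Y W : Type*} [TopologicalSpace Y] [MeasurableSpace Y]
    [OpensMeasurableSpace Y] [HasOuterApproxClosed Y] [TopologicalSpace W] [MeasurableSpace W]
    [OpensMeasurableSpace W] {μs : ℕ → ProbabilityMeasure Y}
    {μ : ProbabilityMeasure Y} (h : Tendsto μs atTop (𝓝 μ)) {f : Y → W} (hf : Measurable f)
    (hc : ∀ᵐ y ∂(μ : Measure Y), ContinuousAt f y) :
    Tendsto (fun N => (μs N).map hf.aemeasurable) atTop (𝓝 (μ.map hf.aemeasurable)) := by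
  refine tendsto_of_forall_isOpen_le_liminf' fun G hG => ?_
  simp only [ProbabilityMeasure.toMeasure_map, Measure.map_apply hf hG.measurableSet]
  calc (μ : Measure Y) (f ⁻¹' G) ≤ (μ : Measure Y) (interior (f ⁻¹' G)) := by
        refine measure_mono_ae ?_
        filter_upwards [hc] with y hy hyG
        exact mem_interior_iff_mem_nhds.2 (hy.preimage_mem_nhds (hG.mem_nhds hyG))
    _ ≤ atTop.liminf fun N => (μs N : Measure Y) (interior (f ⁻¹' G)) :=
        ProbabilityMeasure.le_liminf_measure_open_of_tendsto h isOpen_interior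
    _ ≤ _ := liminf_le_liminf (Eventually.of_forall fun N => measure_mono interior_subset)

/-- Every open set of an induced topology is the preimage of an open set, so the open-set criterion
pulls back. It serves to return from sequences in ℂ to sequences in K. -/
theorem tendsto_of_tendsto_map_isInducing {Y W : Type*} [TopologicalSpace Y] [MeasurableSpace Y]
    [OpensMeasurableSpace Y] [TopologicalSpace W] [MeasurableSpace W]
    [OpensMeasurableSpace W] [HasOuterApproxClosed W] {μs : ℕ → ProbabilityMeasure Y}
    {μ : ProbabilityMeasure Y} {f : Y → W} (hf : Measurable f) (hind : IsInducing f)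
    (h : Tendsto (fun N => (μs N).map hf.aemeasurable) atTop (𝓝 (μ.map hf.aemeasurable))) :
    Tendsto μs atTop (𝓝 μ) := by
  refine tendsto_of_forall_isOpen_le_liminf' fun G hG => ?_
  obtain ⟨G', hG', rfl⟩ := hind.isOpen_iff.1 hG
  have h1 := ProbabilityMeasure.le_liminf_measure_open_of_tendsto h hG'
  simpa only [ProbabilityMeasure.toMeasure_map, Measure.map_apply hf hG'.measurableSet] using h1

/-- The uniform distribution on the first `N + 1` terms of a sequence. -/
noncomputable def empiricalMeasure {Y : Type*} [MeasurableSpace Y] (x : ℕ → Y) (N : ℕ) :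
    ProbabilityMeasure Y :=
  ⟨((N + 1 : ℕ) : ℝ≥0∞)⁻¹ • ∑ m ∈ Finset.range (N + 1), Measure.dirac (x m), ⟨by
    simp only [Measure.smul_apply, Measure.coe_finsetSum, Finset.sum_apply, measure_univ,
      Finset.sum_const, Finset.card_range, nsmul_eq_mul, mul_one, smul_eq_mul]
    exact ENNReal.inv_mul_cancel (by simp) (ENNReal.natCast_ne_top _)⟩⟩

theorem toMeasure_empiricalMeasure {Y : Type*} [MeasurableSpace Y] (x : ℕ → Y) (N : ℕ) :
    (empiricalMeasure x N : Measure Y)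
      = ((N + 1 : ℕ) : ℝ≥0∞)⁻¹ • ∑ m ∈ Finset.range (N + 1), Measure.dirac (x m) := rfl

theorem map_empiricalMeasure {Y W : Type*} [MeasurableSpace Y] [MeasurableSpace W] {f : Y → W}
    (hf : Measurable f) (x : ℕ → Y) (N : ℕ) :
    (empiricalMeasure x N).map hf.aemeasurable = empiricalMeasure (fun m => f (x m)) N := by
  refine Subtype.ext (Measure.ext fun s hs => ?_)
  change (Measure.map f _) s = (empiricalMeasure (fun m => f (x m)) N : Measure W) s
  rw [Measure.map_apply hf hs]
  simp only [toMeasure_empiricalMeasure, Measure.smul_apply, Measure.coe_finsetSum,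
    Finset.sum_apply, Measure.dirac_apply' _ hs, Measure.dirac_apply' _ (hf hs)]
  rfl

theorem integral_empiricalMeasure {Y : Type*} [TopologicalSpace Y] [MeasurableSpace Y]
    [OpensMeasurableSpace Y] (x : ℕ → Y) (N : ℕ) {f : Y → ℂ} (hf : Continuous f) :
    ∫ y, f y ∂(empiricalMeasure x N : Measure Y) = cesaroMean (fun m => f (x m)) (N + 1) := by
  have hint : ∀ m, Integrable f (Measure.dirac (x m)) := fun m =>
    (integrable_dirac' hf.measurable.stronglyMeasurable (by simp))
  rw [toMeasure_empiricalMeasure, integral_smul_measure, integral_finsetSum_measure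
    fun m _ => hint m, cesaroMean]
  simp only [integral_dirac' _ _ hf.measurable.stronglyMeasurable]
  rw [ENNReal.toReal_inv, ENNReal.toReal_natCast, Complex.real_smul]
  push_cast
  rfl

theorem tendsto_empiricalMeasure_iff {Y : Type*} [TopologicalSpace Y] [CompactSpace Y]
    [MeasurableSpace Y] [OpensMeasurableSpace Y] {x : ℕ → Y} {μ : ProbabilityMeasure Y} :
    Tendsto (empiricalMeasure x) atTop (𝓝 μ) ↔
      ∀ f : C(Y, ℂ), Tendsto (cesaroMean fun m => f (x m)) atTop
        (𝓝 (∫ y, f y ∂(μ : Measure Y))) := by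
  rw [ProbabilityMeasure.tendsto_iff_forall_integral_rclike_tendsto ℂ]
  constructor
  · intro h f
    rw [← tendsto_add_atTop_iff_nat 1]
    refine (h (BoundedContinuousFunction.mkOfCompact f)).congr fun N => ?_
    rw [integral_empiricalMeasure x N (BoundedContinuousFunction.continuous _)]
    rfl
  · intro h f
    refine ((tendsto_add_atTop_iff_nat 1).2 (h f.toContinuousMap)).congr fun N => ?_
    rw [integral_empiricalMeasure x N f.continuous]
    rfl

/-! ### Factors of Furstenberg systems -/

theorem IsOrbitLimit.congr {Z : Type*} [MetricSpace Z] [CompactSpace Z] [MeasurableSpace Z]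
    {z z' : ℤ → Z} {μ : Measure (ℤ → Z)} (h : IsOrbitLimit z μ) (hz : ∀ n, 1 ≤ n → z n = z' n) :
    IsOrbitLimit z' μ := by
  refine ⟨h.1, fun f => ?_⟩
  have h1 := h.2 f
  simp only [inv_mul_sum_Icc_eq_cesaroMean] at h1 ⊢
  refine tendsto_cesaroMean_of_sub h1 (tendsto_sub_of_tendsto_uniformity f ?_)
  refine tendsto_pi_uniformity fun n => ?_
  refine (tendsto_diag_uniformity (fun m : ℕ => z (n + (m + 1 : ℕ))) atTop).congr' ?_
  filter_upwards [eventually_ge_atTop (-n).toNat] with m hm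
  rw [iterate_shift_apply, iterate_shift_apply, ← hz _ (by omega)]

theorem isOrbitLimit_iff_tendsto_empiricalMeasure {Z : Type*} [MetricSpace Z] [CompactSpace Z]
    [MeasurableSpace Z] [BorelSpace Z] {z : ℤ → Z} {P : ProbabilityMeasure (ℤ → Z)} :
    IsOrbitLimit z P ↔
      Tendsto (empiricalMeasure fun m => (shift Z)^[m + 1] z) atTop (𝓝 P) := by
  have hP : IsProbabilityMeasure (P : Measure (ℤ → Z)) := inferInstance
  rw [tendsto_empiricalMeasure_iff]
  simp only [IsOrbitLimit, inv_mul_sum_Icc_eq_cesaroMean, hP, true_and]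

theorem measurePreserving_zpow_homeomorph {X : Type*} [TopologicalSpace X] [MeasurableSpace X]
    [BorelSpace X] (S : X ≃ₜ X) {ν : Measure X} (hS : MeasurePreserving S ν ν) (n : ℤ) :
    MeasurePreserving (S ^ n) ν ν := by
  have hS' : MeasurePreserving S.symm ν ν := hS.symm S.toMeasurableEquiv
  induction n using Int.induction_on with
  | zero => simpa using! MeasurePreserving.id ν
  | succ n ih =>
    have : ⇑(S ^ ((n : ℤ) + 1)) = S ∘ ⇑(S ^ (n : ℤ)) :=
      funext fun x => Homeomorph.zpow_one_add_apply S n x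
    rw [this]
    exact hS.comp ih
  | pred n ih =>
    have : ⇑(S ^ (-(n : ℤ) - 1)) = S.symm ∘ ⇑(S ^ (-(n : ℤ))) := by
      ext1 x
      have h := Homeomorph.zpow_one_add_apply S (-n - 1) x
      rw [sub_add_cancel] at h
      rw [Function.comp_apply, h, S.symm_apply_apply]
    rw [this]
    exact hS'.comp ih

/-- The image of a sequence with a unique Furstenberg system under an almost everywhere continuous
function has a unique Furstenberg system, which is a factor of the original one. -/
theorem exists_hasUniqueFurstenbergSystem_comp {X Z : Type*} [TopologicalSpace X]
    [MeasurableSpace X] [BorelSpace X] [MetricSpace Z] [CompactSpace Z] [MeasurableSpace Z]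
    [BorelSpace Z] (S : X ≃ₜ X) {ν : Measure X} [IsProbabilityMeasure ν]
    (hS : MeasurePreserving S ν ν) {q : X → Z} (hq : Measurable q) {c : ℕ → Z}
    (hc : HasUniqueFurstenbergSystem c (ν.map (itinerary S q))) {ψ : Z → ℂ} (hψ : Measurable ψ)
    (hψc : ∀ᵐ y ∂(ν.map q), ContinuousAt ψ y) (K : Set ℂ) [CompactSpace K] (b : ℕ → K)
    (hb : ∀ n, 1 ≤ n → (b n : ℂ) = ψ (c n)) :
    ∃ μ : Measure (ℤ → K), HasUniqueFurstenbergSystem b μ ∧ IsFactorOf μ (shift K) ν S := by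
  classical
  have hK : IsClosed K := (isCompact_iff_compactSpace.2 ‹_›).isClosed
  have hitin := measurable_itinerary S hq
  have hμ := Measure.isProbabilityMeasure_map (μ := ν) hitin.aemeasurable
  obtain ⟨μ, hμdef⟩ : ∃ μ : ProbabilityMeasure (ℤ → Z), (μ : Measure (ℤ → Z)) =
    ν.map (itinerary S q) := ⟨⟨_, hμ⟩, rfl⟩
  rw [← hμdef] at hc
  set z : ℤ → Z := fun n => if 1 ≤ n then c n.toNat else c 1 with hz
  have horb : IsOrbitLimit z μ := hc z fun n hn => by simp [hz, hn]
  have hweak := isOrbitLimit_iff_tendsto_empiricalMeasure.1 horb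
  set Ψ : (ℤ → Z) → ℤ → ℂ := fun y n => ψ (y n) with hΨ
  have hΨm : Measurable Ψ := measurable_pi_lambda _ fun n => hψ.comp (measurable_pi_apply n)
  -- By invariance every coordinate has the law of q under ν, and only countably many null sets have
  -- to be discarded.
  have hΨc : ∀ᵐ y ∂(μ : Measure (ℤ → Z)), ContinuousAt Ψ y := by
    have h1 : ∀ n : ℤ, ∀ᵐ y ∂(μ : Measure (ℤ → Z)), ContinuousAt ψ (y n) := by
      intro n
      have h2 : (μ : Measure (ℤ → Z)).map (fun y => y n) = ν.map q := by
        rw [hμdef, Measure.map_map (measurable_pi_apply n) hitin]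
        conv_rhs => rw [← (measurePreserving_zpow_homeomorph S hS n).map_eq,
          Measure.map_map hq (measurePreserving_zpow_homeomorph S hS n).measurable]
        rfl
      rw [← h2] at hψc
      exact ae_of_ae_map (measurable_pi_apply n).aemeasurable hψc
    filter_upwards [ae_all_iff.2 h1] with y hy
    exact continuousAt_pi.2 fun n => ContinuousAt.comp (g := ψ)
      (f := fun p : ℤ → Z => p n) (hy n) (continuous_apply n).continuousAt
  have hpush := tendsto_map_of_ae_continuousAt hweak hΨm hΨc
  simp only [map_empiricalMeasure hΨm] at hpush
  set ζ : ℤ → K := fun n => if 1 ≤ n then b n.toNat else b 1 with hζ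
  have hζz : ∀ n, (ζ n : ℂ) = ψ (z n) := by
    intro n
    simp only [hζ, hz]
    split_ifs with h
    · exact hb _ (by omega)
    · exact hb 1 le_rfl
  set j : (ℤ → K) → ℤ → ℂ := fun y n => y n with hj
  have hjc : Continuous j := by fun_prop
  have hjinj : Function.Injective j := fun x y h => funext fun n => Subtype.ext (congrFun h n)
  have hjind : IsInducing j := (hjc.isClosedEmbedding hjinj).isInducing
  have horbit : ∀ m, Ψ ((shift Z)^[m] z) = j ((shift K)^[m] ζ) := by
    intro m
    ext n
    simp only [hΨ, hj, iterate_shift_apply, hζz]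
  simp only [horbit] at hpush
  -- Only the values of ψ along c are assumed to lie in K. As K is closed and all the empirical
  -- measures are carried by it, so is their weak limit.
  have hmem : ∀ᵐ x ∂ν, ψ (q x) ∈ K := by
    have hclosed : IsClosed {y : ℤ → ℂ | y 0 ∈ K} := hK.preimage (continuous_apply 0)
    have h1 := ProbabilityMeasure.limsup_measure_closed_le_of_tendsto hpush hclosed
    have h2 : ∀ N, (empiricalMeasure (fun m => j ((shift K)^[m + 1] ζ)) N : Measure (ℤ → ℂ))
        {y : ℤ → ℂ | y 0 ∈ K} = 1 := by
      intro N
      rw [← map_empiricalMeasure hjc.measurable, ProbabilityMeasure.toMeasure_map,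
        Measure.map_apply hjc.measurable hclosed.measurableSet]
      rw [show j ⁻¹' {y : ℤ → ℂ | y 0 ∈ K} = Set.univ from
        Set.eq_univ_of_forall fun y => (y 0).2, measure_univ]
    simp only [h2, limsup_const, ProbabilityMeasure.toMeasure_map] at h1
    rw [Measure.map_apply hΨm hclosed.measurableSet, hμdef,
      Measure.map_apply hitin (hΨm hclosed.measurableSet)] at h1
    have h3 := (mem_ae_iff_prob_eq_one (hitin (hΨm hclosed.measurableSet))).2
      (le_antisymm prob_le_one h1)
    filter_upwards [h3] with x hx
    simpa [hΨ, itinerary] using hx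
  -- The default value b 1 is used only on a null set; it makes the factor map take values in K
  -- everywhere.
  set ψK : Z → K := fun y => ⟨if ψ y ∈ K then ψ y else b 1, by
    split_ifs with h
    exacts [h, (b 1).2]⟩ with hψK
  have hψKm : Measurable ψK :=
    (Measurable.ite (hψ hK.measurableSet) hψ measurable_const).subtype_mk
  have hqK : Measurable (fun x => ψK (q x)) := hψKm.comp hq
  have hitinK := measurable_itinerary S hqK
  have hμK := Measure.isProbabilityMeasure_map (μ := ν) hitinK.aemeasurable
  refine ⟨ν.map (itinerary S fun x => ψK (q x)), fun z' hz' => ?_, isFactorOf_itinerary S hS hqK⟩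
  obtain ⟨μK, hμKdef⟩ : ∃ μ : ProbabilityMeasure (ℤ → K), (μ : Measure (ℤ → K)) =
    ν.map (itinerary S fun x => ψK (q x)) := ⟨⟨_, hμK⟩, rfl⟩
  rw [← hμKdef]
  suffices h : IsOrbitLimit ζ μK by
    refine h.congr fun n hn => ?_
    have h1 := hz' n.toNat (by omega)
    rw [show ((n.toNat : ℕ) : ℤ) = n by omega] at h1
    simp only [hζ, if_pos hn, h1]
  rw [isOrbitLimit_iff_tendsto_empiricalMeasure]
  refine tendsto_of_tendsto_map_isInducing hjc.measurable hjind ?_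
  simp only [map_empiricalMeasure hjc.measurable]
  convert hpush using 2
  refine Subtype.ext ?_
  change (μK : Measure (ℤ → K)).map j = (μ : Measure (ℤ → Z)).map Ψ
  rw [hμdef, hμKdef, Measure.map_map hjc.measurable hitinK, Measure.map_map hΨm hitin]
  refine Measure.map_congr ?_
  have hall : ∀ n : ℤ, ∀ᵐ x ∂ν, ψ (q ((S ^ n) x)) ∈ K := fun n =>
    (measurePreserving_zpow_homeomorph S hS n).quasiMeasurePreserving.ae hmem
  filter_upwards [ae_all_iff.2 hall] with x hx
  ext n
  simp only [Function.comp_apply, hj, hΨ, itinerary, hψK, if_pos (hx n)]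

/-! ### Riemann-integrable functions -/

namespace RealRiemannIntegrable

variable {Y : Type*} [MetricSpace Y] [CompactSpace Y] [MeasurableSpace Y] [BorelSpace Y]
  {φ : Y → ℝ} {ν : Measure Y}

theorem exists_abs_le (h : RealRiemannIntegrable φ ν) : ∃ C, ∀ y, |φ y| ≤ C := by
  obtain ⟨φl, φu, h1, -⟩ := h.2 1 one_pos
  refine ⟨max ‖φl‖ ‖φu‖, fun y => abs_le.2 ⟨?_, ?_⟩⟩
  · have h2 := neg_le_of_abs_le (φl.norm_coe_le_norm y)
    have := le_max_left ‖φl‖ ‖φu‖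
    linarith [(h1 y).1]
  · have h2 := le_of_abs_le (φu.norm_coe_le_norm y)
    have := le_max_right ‖φl‖ ‖φu‖
    linarith [(h1 y).2]

/-- Markov's inequality for a sandwich with gap integral at most δε bounds the exceptional set by ε,
for every ε. The sandwich may depend on the point. -/
theorem ae_exists_sub_lt [IsFiniteMeasure ν] (h : RealRiemannIntegrable φ ν) {δ : ℝ} (hδ : 0 < δ) :
    ∀ᵐ y ∂ν, ∃ φl φu : C(Y, ℝ), (∀ y, φl y ≤ φ y ∧ φ y ≤ φu y) ∧ φu y - φl y < δ := by
  rw [ae_iff, ← measureReal_eq_zero_iff]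
  refine le_antisymm (le_of_forall_pos_le_add fun ε hε => ?_) measureReal_nonneg
  obtain ⟨φl, φu, h1, h2⟩ := h.2 (δ * ε) (by positivity)
  have hint : Integrable (fun y => φu y - φl y) ν :=
    (BoundedContinuousFunction.mkOfCompact (φu - φl)).integrable ν
  have h3 := mul_meas_ge_le_integral_of_nonneg (μ := ν) (f := fun y => φu y - φl y)
    (Eventually.of_forall fun y => by
      have := h1 y
      simp only [Pi.zero_apply]
      linarith) hint δ
  rw [zero_add]
  refine le_of_mul_le_mul_left ((mul_le_mul_of_nonneg_left ?_ hδ.le).trans (h3.trans h2)) hδ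
  refine measureReal_mono fun y hy => ?_
  by_contra hlt
  exact hy ⟨φl, φu, h1, not_le.1 hlt⟩

/-- Where the gap of continuous sandwiches can be made arbitrarily small, φ is squeezed into
continuity. -/
theorem ae_continuousAt [IsFiniteMeasure ν] (h : RealRiemannIntegrable φ ν) :
    ∀ᵐ y ∂ν, ContinuousAt φ y := by
  have h1 := ae_all_iff.2 fun k : ℕ =>
    h.ae_exists_sub_lt (δ := 1 / ((k : ℝ) + 1)) (by positivity)
  filter_upwards [h1] with y hy
  rw [Metric.continuousAt_iff']
  intro ε hε
  obtain ⟨k, hk⟩ := exists_nat_one_div_lt (half_pos hε)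
  obtain ⟨φl, φu, hφ, hlt⟩ := hy k
  have hu := φu.continuous.continuousAt.eventually_lt_const
    (show φu y < φu y + ε / 2 by linarith)
  have hl := φl.continuous.continuousAt.eventually_const_lt
    (show φl y - ε / 2 < φl y by linarith)
  filter_upwards [hu, hl] with x hxu hxl
  rw [Real.dist_eq, abs_lt]
  have := hφ x
  have := hφ y
  constructor <;> linarith

end RealRiemannIntegrable

namespace RiemannIntegrable

variable {Y : Type*} [MetricSpace Y] [CompactSpace Y] [MeasurableSpace Y] [BorelSpace Y]
  {φ : Y → ℂ} {ν : Measure Y}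

theorem measurable (h : RiemannIntegrable φ ν) : Measurable φ :=
  measurable_of_re_im (𝕜 := ℂ) h.1.1 h.2.1

theorem isBounded_range (h : RiemannIntegrable φ ν) : Bornology.IsBounded (Set.range φ) := by
  obtain ⟨C, hC⟩ := h.1.exists_abs_le
  obtain ⟨D, hD⟩ := h.2.exists_abs_le
  refine isBounded_iff_forall_norm_le.2 ⟨C + D, ?_⟩
  rintro _ ⟨y, rfl⟩
  exact (Complex.norm_le_abs_re_add_abs_im _).trans (add_le_add (hC y) (hD y))

theorem ae_continuousAt [IsFiniteMeasure ν] (h : RiemannIntegrable φ ν) :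
    ∀ᵐ y ∂ν, ContinuousAt φ y := by
  filter_upwards [h.1.ae_continuousAt, h.2.ae_continuousAt] with y hre him
  have h1 : φ = fun y => ((φ y).re : ℂ) + (φ y).im * Complex.I :=
    funext fun y => (Complex.re_add_im _).symm
  rw [h1]
  exact (Complex.continuous_ofReal.continuousAt.comp hre).add
    ((Complex.continuous_ofReal.continuousAt.comp him).mul continuousAt_const)

end RiemannIntegrable

/-! ### Integer parts modulo one -/

/-- The function of `(a, α a)` modulo one that gives `⌊a⌋ α` modulo one. -/
noncomputable def floorMul (α : ℝ) (y : UnitAddCircle × UnitAddCircle) : UnitAddCircle :=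
  y.2 - ((α * (AddCircle.equivIco 1 0 y.1 : ℝ) : ℝ) : UnitAddCircle)

theorem floorMul_coe (α t : ℝ) :
    floorMul α ((t : UnitAddCircle), ((α * t : ℝ) : UnitAddCircle))
      = (((⌊t⌋ : ℝ) * α : ℝ) : UnitAddCircle) := by
  have h := AddCircle.coe_equivIco_mk_apply (1 : ℝ) t
  simp only [div_one, mul_one] at h
  rw [floorMul, ← AddCircle.coe_sub]
  congr 1
  change α * t - α * (AddCircle.equivIco 1 0 (QuotientAddGroup.mk t) : ℝ) = _
  rw [h, Int.fract]
  ring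

theorem measurable_coe_equivIco :
    Measurable fun x : UnitAddCircle => (AddCircle.equivIco (1 : ℝ) 0 x : ℝ) :=
  measurable_subtype_coe.comp (AddCircle.measurableEquivIco 1 0).measurable

/-- With the first coordinate fixed this is a translation of the circle, so it is a skew product
followed by a projection. -/
theorem measurePreserving_floorMul (α : ℝ) : MeasurePreserving (floorMul α) volume volume := by
  have hm : Measurable (Function.uncurry fun x y : UnitAddCircle => floorMul α (x, y)) := by
    have h1 : Measurable fun x : UnitAddCircle =>
        ((α * (AddCircle.equivIco (1 : ℝ) 0 x : ℝ) : ℝ) : UnitAddCircle) :=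
      AddCircle.measurable_mk'.comp (measurable_coe_equivIco.const_mul α)
    exact measurable_snd.sub (h1.comp measurable_fst)
  have h := (MeasurePreserving.id (volume : Measure UnitAddCircle)).skew_product
    (μc := (volume : Measure UnitAddCircle)) (μd := volume) hm
    (Eventually.of_forall fun x => (measurePreserving_sub_right (volume : Measure UnitAddCircle)
      ((α * (AddCircle.equivIco (1 : ℝ) 0 x : ℝ) : ℝ) : UnitAddCircle)).map_eq)
  exact measurePreserving_snd.comp h

theorem ae_continuousAt_floorMul (α : ℝ) :
    ∀ᵐ y ∂(volume : Measure (UnitAddCircle × UnitAddCircle)), ContinuousAt (floorMul α) y := by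
  have h0 : ∀ᵐ x ∂(volume : Measure UnitAddCircle), x ≠ 0 := by
    rw [ae_iff]
    simpa using AddCircle.volume_closedBall (T := 1) (x := 0) 0
  have h1 : ∀ᵐ y ∂(volume : Measure (UnitAddCircle × UnitAddCircle)), y.1 ≠ 0 :=
    (measurePreserving_fst (μ := (volume : Measure UnitAddCircle))
      (ν := (volume : Measure UnitAddCircle))).quasiMeasurePreserving.ae h0
  filter_upwards [h1] with y hy
  have h2 : ContinuousAt (fun x : UnitAddCircle => (AddCircle.equivIco (1 : ℝ) 0 x : ℝ)) y.1 :=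
    continuousAt_subtype_val.comp (AddCircle.continuousAt_equivIco 1 0 (by simpa using hy))
  have h3 : ContinuousAt (fun y : UnitAddCircle × UnitAddCircle =>
      (AddCircle.equivIco (1 : ℝ) 0 y.1 : ℝ)) y :=
    ContinuousAt.comp (g := fun x : UnitAddCircle => (AddCircle.equivIco (1 : ℝ) 0 x : ℝ))
      (f := Prod.fst) h2 continuousAt_fst
  exact continuousAt_snd.sub
    ((AddCircle.continuous_mk' 1).continuousAt.comp (continuousAt_const.mul h3))

/-! ### Hardy fields give sequence fields -/

/-- The sequences of values at the natural numbers of the functions with germs in `H`. -/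
def hardySequences (H : Subring (Germ (atTop : Filter ℝ) ℝ)) : Set (ℕ → ℝ) :=
  {s | ∃ f : ℝ → ℝ, (f : Germ (atTop : Filter ℝ) ℝ) ∈ H ∧ s = fun n : ℕ => f n}

namespace IsHardyField

variable {H : Subring (Germ (atTop : Filter ℝ) ℝ)} (hH : IsHardyField H)
include hH

theorem exists_inv {f : ℝ → ℝ} (hf : (f : Germ (atTop : Filter ℝ) ℝ) ∈ H)
    (h0 : ¬ ∀ᶠ t in atTop, f t = 0) :
    ∃ g : ℝ → ℝ, (g : Germ (atTop : Filter ℝ) ℝ) ∈ H ∧ ∀ᶠ t in atTop, f t * g t = 1 := by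
  have hne : (⟨f, hf⟩ : H) ≠ 0 := by
    intro h
    have h1 : (f : Germ (atTop : Filter ℝ) ℝ) = ((0 : ℝ → ℝ) : Germ (atTop : Filter ℝ) ℝ) :=
      congrArg Subtype.val h
    exact h0 (Germ.coe_eq.1 h1)
  obtain ⟨⟨g, hg⟩, hfg⟩ := hH.isField.mul_inv_cancel hne
  induction g using Germ.inductionOn with
  | _ g =>
    have h1 : ((f * g : ℝ → ℝ) : Germ (atTop : Filter ℝ) ℝ) = ((1 : ℝ → ℝ) : Germ _ ℝ) :=
      congrArg Subtype.val hfg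
    exact ⟨g, hg, Germ.coe_eq.1 h1⟩

/-- A nonzero germ is invertible, so it eventually has no zeros; being eventually continuous, it
keeps its sign by the intermediate value theorem. -/
theorem eventual_sign {f : ℝ → ℝ} (hf : (f : Germ (atTop : Filter ℝ) ℝ) ∈ H) :
    (∀ᶠ t in atTop, 0 < f t) ∨ (∀ᶠ t in atTop, f t = 0) ∨ (∀ᶠ t in atTop, f t < 0) := by
  by_cases h0 : ∀ᶠ t in atTop, f t = 0
  · exact Or.inr (Or.inl h0)
  obtain ⟨g, -, hfg⟩ := hH.exists_inv hf h0
  obtain ⟨T, hT⟩ := eventually_atTop.1 (hfg.and (hH.deriv_mem f hf).1)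
  have hne : ∀ t, T ≤ t → f t ≠ 0 := fun t ht h => by
    have := (hT t ht).1
    rw [h, zero_mul] at this
    exact zero_ne_one this
  have hcont : ∀ t, ContinuousOn f (Set.Icc T t) := fun t x hx =>
    (hT x hx.1).2.continuousAt.continuousWithinAt
  rcases lt_or_gt_of_ne (hne T le_rfl) with h | h
  · refine Or.inr (Or.inr (eventually_atTop.2 ⟨T, fun t ht => ?_⟩))
    by_contra hlt
    obtain ⟨x, hx, hx0⟩ := intermediate_value_Icc ht (hcont t) ⟨h.le, not_lt.1 hlt⟩
    exact hne x hx.1 hx0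
  · refine Or.inl (eventually_atTop.2 ⟨T, fun t ht => ?_⟩)
    by_contra hlt
    obtain ⟨x, hx, hx0⟩ := intermediate_value_Icc' ht (hcont t) ⟨not_lt.1 hlt, h.le⟩
    exact hne x hx.1 hx0

theorem isSequenceField : IsSequenceField (hardySequences H) where
  one_mem := ⟨1, H.one_mem, rfl⟩
  add_mem := by
    rintro _ ⟨f, hf, rfl⟩ _ ⟨g, hg, rfl⟩
    exact ⟨f + g, H.add_mem hf hg, rfl⟩
  neg_mem := by
    rintro _ ⟨f, hf, rfl⟩
    exact ⟨-f, H.neg_mem hf, rfl⟩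
  mul_mem := by
    rintro _ ⟨f, hf, rfl⟩ _ ⟨g, hg, rfl⟩
    exact ⟨f * g, H.mul_mem hf hg, rfl⟩
  shift_mem := by
    rintro _ ⟨f, hf, rfl⟩
    exact ⟨_, hH.translate_mem f 1 hf, by simp⟩
  exists_inv := by
    rintro _ ⟨f, hf, rfl⟩ h0
    obtain ⟨g, hg, hfg⟩ := hH.exists_inv hf fun h =>
      h0 (tendsto_natCast_atTop_atTop.eventually h)
    exact ⟨_, ⟨g, hg, rfl⟩, tendsto_natCast_atTop_atTop.eventually hfg⟩
  sign := by
    rintro _ ⟨f, hf, rfl⟩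
    rcases hH.eventual_sign hf with h | h | h
    · exact Or.inl (tendsto_natCast_atTop_atTop.eventually h)
    · exact Or.inr (Or.inl (tendsto_natCast_atTop_atTop.eventually h))
    · exact Or.inr (Or.inr (tendsto_natCast_atTop_atTop.eventually h))

end IsHardyField

theorem theorem1p5 (d : ℕ) (a : ℝ → ℝ) (ha : IsHardyFieldFunction a)
    (hlow : (fun t : ℝ => t ^ d * Real.log t) =o[atTop] a)
    (hup : a =o[atTop] (fun t : ℝ => t ^ (d + 1)))
    (α : ℝ) (hα : Irrational α) :
    (∀ φ : UnitAddCircle → ℂ, RiemannIntegrable φ volume →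
      Bornology.IsBounded (Set.range φ) ∧
      ∀ (K : Set ℂ) [CompactSpace K] (b : ℕ → K),
        (∀ n : ℕ, 1 ≤ n → (b n : ℂ) = φ (((⌊a n⌋ : ℝ) * α : ℝ) : UnitAddCircle)) →
        ∃ μ : Measure (ℤ → K), HasUniqueFurstenbergSystem b μ ∧
          IsFactorOf μ (shift K)
            (volume : Measure ((Fin (d + 1) → UnitAddCircle) × (Fin (d + 1) → UnitAddCircle)))
            (Prod.map (unipotent d) (unipotent d))) ∧
    ∃ μ : Measure (ℤ → UnitAddCircle × UnitAddCircle),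
      HasUniqueFurstenbergSystem
        (fun n : ℕ => ((a n : UnitAddCircle), ((α * a n : ℝ) : UnitAddCircle))) μ ∧
      IsIsomorphicTo μ (shift (UnitAddCircle × UnitAddCircle))
        (volume : Measure ((Fin (d + 1) → UnitAddCircle) × (Fin (d + 1) → UnitAddCircle)))
        (Prod.map (unipotent d) (unipotent d)) := by
  obtain ⟨H, hH, haH⟩ := ha
  have hpair := hH.isSequenceField.hasUniqueFurstenbergSystem_pair (s := fun n : ℕ => a n)
    ⟨a, haH, rfl⟩ d (hlow.comp_tendsto tendsto_natCast_atTop_atTop)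
    (hup.comp_tendsto tendsto_natCast_atTop_atTop) hα
  have hS := measurePreserving_unipotentSquare d
  refine ⟨fun φ hφ => ⟨hφ.isBounded_range, fun K _ b hb => ?_⟩, _, hpair,
    isIsomorphicTo_itinerary _ hS (continuous_lastPair d) (injective_itinerary_lastPair d)⟩
  refine exists_hasUniqueFurstenbergSystem_comp (unipotentSquare d) hS
    (continuous_lastPair d).measurable hpair (ψ := fun y => φ (floorMul α y))
    (hφ.measurable.comp (measurePreserving_floorMul α).measurable) ?_ K b
    (fun n hn => by rw [hb n hn, floorMul_coe])
  rw [(measurePreserving_lastPair d).map_eq]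
  -- Since `floorMul α` preserves Haar measure, the discontinuities of φ pull back to a null set.
  filter_upwards [ae_continuousAt_floorMul α,
    (measurePreserving_floorMul α).quasiMeasurePreserving.ae hφ.ae_continuousAt] with y h1 h2
  exact ContinuousAt.comp h2 h1
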